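/- Let $n\ge 1$. A Young's function is a map $\Phi:[0,\infty]\to[0,\infty]$ with $\Phi(0)=0$ such that either (I) $\Phi$ is convex, increasing (i.e. non-decreasing), finite-valued and not identically zero on $[0,\infty)$; or (II) for some $b\in(0,\infty)$, $\Phi$ is convex, increasing and finite-valued on $[0,b]$ and $\Phi=\infty$ on $(b,\infty]$; or (III) for some $b\in(0,\infty)$, $\Phi$ is convex, increasing and finite-valued on $[0,b)$, $\Phi(x)\to\infty$ as $x\uparrow b$, and $\Phi=\infty$ on $[b,\infty]$. It is an $N$-function if it is of type (I), positive on $(0,\infty)$, and $\Phi(x)/x\to0$ as $x\to0$, $x/\Phi(x)\to0$ as $x\to\infty$. Its generalised inverse is $\Phi^{-1}(y)=\inf\{x>0:\Phi(x)>y\}$ ($\inf\emptyset=\infty$). The Orlicz space $L^\Phi=L^\Phi(\mathbb R^n)$ consists of the (a.e. classes of) measurable $u:\mathbb R^n\to\mathbb R$ with $\int\Phi(|u|/k)\,dx<\infty$ for some $k>0$, with the Luxemburg norm $\|u\|_\Phi=\inf\{k>0:\int\Phi(|u|/k)\,dx\le1\}$; $L^\Phi_0$ is the closure of $C_0^\infty(\mathbb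 R^n)$ (smooth compactly supported functions) in $L^\Phi$; and the Morse--Transue space $M^\Phi$ consists of the measurable $u$ with $\int\Phi(|u|/k)\,dx<\infty$ for all $k>0$, with the norm $\|\cdot\|_\Phi$. The heat semigroup is $S(0)\varphi=\varphi$ and $$[S(t)\varphi](x)=\int_{\mathbb R^n}(4\pi t)^{-n/2}e^{-|x-y|^2/(4t)}\varphi(y)\,dy,\qquad t>0 .$$ **Theorem A (Heat semigroup).** Let $\Phi$ be a Young's function. (a) (i) For $\varphi\in L^\Phi$ the integral defining $S(t)\varphi(x)$ converges absolutely for all $t>0$ and $x\in\mathbb R^n$, and $S(t)$ is a semigroup of bounded linear operators on $L^\Phi$ with $\|S(t)\varphi\|_\Phi\le2\|\varphi\|_\Phi$ for all $\varphi\in L^\Phi$ and $t\ge0$. (ii) For all $\varphi\in L^\Phi_0$, $\|S(t)\varphi-\varphi\|_\Phi\to0$ as $t\to0$. (iii) If $\Phi$ is an $N$-function, then $S(t)$ restricts to a $C_0$-semigroup on $M^\Phi$, satisfying the estimate in (i) for all $\varphi\in M^\Phi$ and $t\ge0$. (b) Let $\Psi$ be a Young's function and suppose there exist $\beta\in(0,1)$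 and a Young's function $\Theta$ such that $$\beta x\Psi^{-1}(x)\le\Phi^{-1}(x)\,\Theta^{-1}(x)\le x\Psi^{-1}(x),\qquad x\ge0 .$$ (i) For all $t>0$, $S(t):L^\Phi\to L^\Psi$ is a bounded linear operator, and there is a constant $C=C(n,\Phi,\Psi)>0$ such that for all $\varphi\in L^\Phi$ and $t>0$, $$\|S(t)\varphi\|_\Psi\le C\,\frac{\Phi^{-1}(t^{-n/2})}{\Psi^{-1}(t^{-n/2})}\,\|\varphi\|_\Phi .$$ (ii) If $\lim_{s\to\infty}\Psi^{-1}(s)/\Phi^{-1}(s)=0$, then $$\lim_{t\to0}\ \frac{\Psi^{-1}(t^{-n/2})}{\Phi^{-1}(t^{-n/2})}\,\|S(t)\varphi\|_\Psi=0$$ uniformly for $\varphi$ in compact subsets of $L^\Phi_0$. -/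

import Mathlib

open MeasureTheory Filter Topology Set
open scoped NNReal ENNReal

noncomputable section

/-! ### Young's functions -/

/-- Type (I): convex, increasing, finite-valued and not identically zero on `[0, ∞)`. -/
def IsYoungI (Φ : ℝ≥0∞ → ℝ≥0∞) : Prop :=
  ConvexOn ℝ≥0 (Iio ∞) Φ ∧ MonotoneOn Φ (Iio ∞) ∧ (∀ x ∈ Iio ∞, Φ x < ∞) ∧
    ∃ x ∈ Iio ∞, Φ x ≠ 0

/-- Type (II): for some `b ∈ (0, ∞)`, convex, increasing and finite-valued on `[0, b]`, and
infinite on `(b, ∞]`. -/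
def IsYoungII (Φ : ℝ≥0∞ → ℝ≥0∞) : Prop :=
  ∃ b : ℝ≥0∞, 0 < b ∧ b < ∞ ∧ ConvexOn ℝ≥0 (Iic b) Φ ∧ MonotoneOn Φ (Iic b) ∧
    (∀ x ∈ Iic b, Φ x < ∞) ∧ ∀ x, b < x → Φ x = ∞

/-- Type (III): for some `b ∈ (0, ∞)`, convex, increasing and finite-valued on `[0, b)`, with
limit `∞` from the left at `b`, and infinite on `[b, ∞]`. -/
def IsYoungIII (Φ : ℝ≥0∞ → ℝ≥0∞) : Prop :=
  ∃ b : ℝ≥0∞, 0 < b ∧ b < ∞ ∧ ConvexOn ℝ≥0 (Iio b) Φ ∧ MonotoneOn Φ (Iio b) ∧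
    (∀ x ∈ Iio b, Φ x < ∞) ∧ Tendsto Φ (𝓝[<] b) (𝓝 ∞) ∧ ∀ x, b ≤ x → Φ x = ∞

/-- (Nontrivial, possibly extended-valued) Young's functions `Φ : [0, ∞] → [0, ∞]`. -/
structure YoungFunction where
  toFun : ℝ≥0∞ → ℝ≥0∞
  zero' : toFun 0 = 0
  young' : IsYoungI toFun ∨ IsYoungII toFun ∨ IsYoungIII toFun

namespace YoungFunction

instance : CoeFun YoungFunction (fun _ => ℝ≥0∞ → ℝ≥0∞) := ⟨YoungFunction.toFun⟩

/-- `Φ` is finite if it is of type (I). -/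
def IsFinite (Φ : YoungFunction) : Prop := IsYoungI Φ

/-- `N`-functions: finite, positive on `(0, ∞)`, with `Φ(x)/x → 0` as `x → 0` and
`x/Φ(x) → 0` as `x → ∞`. -/
def IsNFunction (Φ : YoungFunction) : Prop :=
  Φ.IsFinite ∧ (∀ x : ℝ≥0, 0 < x → 0 < Φ x) ∧
    Tendsto (fun x : ℝ≥0 => Φ x / x) (𝓝[>] 0) (𝓝 0) ∧
    Tendsto (fun x : ℝ≥0 => x / Φ x) atTop (𝓝 0)

/-- The generalised inverse `Φ⁻¹(y) = inf {x > 0 : Φ(x) > y}`, with `inf ∅ = ∞`. -/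
def inv (Φ : YoungFunction) (y : ℝ≥0∞) : ℝ≥0∞ := sInf {x | 0 < x ∧ y < Φ x}

/-- The compatibility condition between `Φ` and `Ψ`: for some `β ∈ (0, 1)` and some Young's
function `Θ`, `β x Ψ⁻¹(x) ≤ Φ⁻¹(x) Θ⁻¹(x) ≤ x Ψ⁻¹(x)` for all `x ∈ [0, ∞)`. -/
def Compatible (Φ Ψ : YoungFunction) : Prop :=
  ∃ β : ℝ≥0, 0 < β ∧ β < 1 ∧ ∃ Θ : YoungFunction, ∀ x : ℝ≥0,
    β * x * Ψ.inv x ≤ Φ.inv x * Θ.inv x ∧ Φ.inv x * Θ.inv x ≤ x * Ψ.inv x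

variable (Φ : YoungFunction)

theorem mono {x y : ℝ≥0∞} (hxy : x ≤ y) (hy : y < ∞) : Φ x ≤ Φ y := by
  rcases Φ.young' with h | ⟨b, -, -, -, h, -, h'⟩ | ⟨b, -, -, -, h, -, -, h'⟩
  · exact h.2.1 (lt_of_le_of_lt hxy hy) hy hxy
  · by_cases hb : y ≤ b
    · exact h (hxy.trans hb) hb hxy
    · rw [h' y (not_le.1 hb)]; exact le_top
  · by_cases hb : y < b
    · exact h (lt_of_le_of_lt hxy hb) hb hxy
    · rw [h' y (not_lt.1 hb)]; exact le_top

theorem convex {x y : ℝ≥0∞} (hx : x < ∞) (hy : y < ∞) (a b : ℝ≥0) (hab : a + b = 1) :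
    Φ (a * x + b * y) ≤ a * Φ x + b * Φ y := by
  rcases eq_or_ne a 0 with rfl | ha
  · obtain rfl : b = 1 := by simpa using hab
    simp
  rcases eq_or_ne b 0 with rfl | hb
  · obtain rfl : a = 1 := by simpa using hab
    simp
  have key : ∀ D : Set ℝ≥0∞, ConvexOn ℝ≥0 D Φ → (∀ z, z < ∞ → z ∉ D → Φ z = ∞) →
      Φ (a * x + b * y) ≤ a * Φ x + b * Φ y := by
    intro D hD hD'
    by_cases hxD : x ∈ D
    · by_cases hyD : y ∈ D
      · have := hD.2 hxD hyD (zero_le (a := a)) (zero_le (a := b)) hab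
        simpa [ENNReal.smul_def] using this
      · rw [hD' y hy hyD, ENNReal.mul_top (by simpa using hb), add_top]; exact le_top
    · rw [hD' x hx hxD, ENNReal.mul_top (by simpa using ha), top_add]; exact le_top
  rcases Φ.young' with h | ⟨c, -, -, h, -, -, h'⟩ | ⟨c, -, -, h, -, -, -, h'⟩
  · exact key _ h.1 (fun z hz hz' => absurd hz hz')
  · exact key _ h (fun z _ hz' => h' z (not_le.1 hz'))
  · exact key _ h (fun z _ hz' => h' z (not_lt.1 hz'))

theorem exists_pos : ∃ x : ℝ, 0 < x ∧ 0 < Φ (ENNReal.ofReal x) := by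
  have key : ∃ x : ℝ≥0∞, x < ∞ ∧ Φ x ≠ 0 := by
    rcases Φ.young' with h | ⟨b, -, hb, -, -, -, h'⟩ | ⟨b, -, hb, -, -, -, -, h'⟩
    · obtain ⟨x, hx, h⟩ := h.2.2.2
      exact ⟨x, hx, h⟩
    · obtain ⟨x, hx, hx'⟩ := exists_between hb
      exact ⟨x, hx', by rw [h' x hx]; simp⟩
    · exact ⟨b, hb, by rw [h' b le_rfl]; simp⟩
  obtain ⟨x, hx, h⟩ := key
  refine ⟨x.toReal, ENNReal.toReal_pos ?_ hx.ne, ?_⟩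
  · rintro rfl; exact h Φ.zero'
  · rw [ENNReal.ofReal_toReal hx.ne]; exact pos_iff_ne_zero.2 h

theorem mono_real : Monotone fun r : ℝ => Φ (ENNReal.ofReal r) := fun _ _ h =>
  Φ.mono (ENNReal.ofReal_le_ofReal h) ENNReal.ofReal_lt_top

theorem convex_real {r s a b : ℝ} (hr : 0 ≤ r) (hs : 0 ≤ s) (ha : 0 ≤ a) (hb : 0 ≤ b)
    (hab : a + b = 1) : Φ (ENNReal.ofReal (a * r + b * s)) ≤
      ENNReal.ofReal a * Φ (ENNReal.ofReal r) + ENNReal.ofReal b * Φ (ENNReal.ofReal s) := by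
  have h := Φ.convex (x := ENNReal.ofReal r) (y := ENNReal.ofReal s) ENNReal.ofReal_lt_top
    ENNReal.ofReal_lt_top a.toNNReal b.toNNReal
    (by rw [← Real.toNNReal_add ha hb, hab, Real.toNNReal_one])
  rw [ENNReal.ofReal_add (mul_nonneg ha hr) (mul_nonneg hb hs), ENNReal.ofReal_mul ha,
    ENNReal.ofReal_mul hb]
  exact h

end YoungFunction

/-! ### Orlicz spaces on `ℝⁿ` -/

/-- The modular `∫ Φ(|u(x)|/k) dx`. -/
def modular {n : ℕ} (Φ : YoungFunction) (u : EuclideanSpace ℝ (Fin n) → ℝ) (k : ℝ) : ℝ≥0∞ :=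
  ∫⁻ x, Φ (ENNReal.ofReal (|u x| / k))

section modular

variable {n : ℕ} (Φ : YoungFunction) {u v : EuclideanSpace ℝ (Fin n) → ℝ} {k l : ℝ}

theorem modular_congr (h : u =ᵐ[volume] v) : modular Φ u k = modular Φ v k :=
  lintegral_congr_ae (by filter_upwards [h] with x hx; rw [hx])

theorem modular_anti (hk : 0 < k) (hkl : k ≤ l) : modular Φ u l ≤ modular Φ u k :=
  lintegral_mono fun x => Φ.mono_real (by gcongr)

theorem modular_zero : modular Φ (0 : EuclideanSpace ℝ (Fin n) → ℝ) k = 0 := by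
  simp [modular, Φ.zero']

theorem modular_smul {c : ℝ} (hc : c ≠ 0) : modular Φ (c • u) (|c| * k) = modular Φ u k := by
  have : |c| ≠ 0 := abs_ne_zero.2 hc
  simp only [modular, Pi.smul_apply, smul_eq_mul, abs_mul, mul_div_mul_left _ _ this]

theorem modular_add (hu : AEMeasurable u) (hk : 0 < k) (hl : 0 < l) :
    modular Φ (u + v) (k + l) ≤ ENNReal.ofReal (k / (k + l)) * modular Φ u k +
      ENNReal.ofReal (l / (k + l)) * modular Φ v l := by
  have hm : AEMeasurable fun x => Φ (ENNReal.ofReal (|u x| / k)) :=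
    Φ.mono_real.measurable.comp_aemeasurable
      ((continuous_abs.measurable.comp_aemeasurable hu).div_const k)
  unfold modular
  rw [← lintegral_const_mul' _ _ ENNReal.ofReal_ne_top,
    ← lintegral_const_mul' _ _ ENNReal.ofReal_ne_top, ← lintegral_add_left' (hm.const_mul _)]
  refine lintegral_mono fun x => ?_
  refine le_trans (Φ.mono_real (?_ : _ ≤ k / (k + l) * (|u x| / k) + l / (k + l) * (|v x| / l)))
    (Φ.convex_real (by positivity) (by positivity) (by positivity) (by positivity)
      (by field_simp))
  have : k / (k + l) * (|u x| / k) + l / (k + l) * (|v x| / l) = (|u x| + |v x|) / (k + l) := by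
    field_simp
  rw [this]
  exact div_le_div_of_nonneg_right (abs_add_le _ _) (by positivity)

theorem modular_scale {a : ℝ} (ha : 0 < a) (ha1 : a ≤ 1) (hk : 0 < k) :
    modular Φ u (k / a) ≤ ENNReal.ofReal a * modular Φ u k := by
  unfold modular
  rw [← lintegral_const_mul' _ _ ENNReal.ofReal_ne_top]
  refine lintegral_mono fun x => ?_
  have := Φ.convex_real (r := |u x| / k) (s := 0) (by positivity) le_rfl ha.le
    (sub_nonneg.2 ha1) (by ring)
  simp only [mul_zero, add_zero, ENNReal.ofReal_zero, Φ.zero'] at this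
  refine le_trans (le_of_eq ?_) this
  congr 2
  field_simp

end modular

/-- The Luxemburg norm `inf {k > 0 : ∫ Φ(|u(x)|/k) dx ≤ 1}`. -/
def luxemburg {n : ℕ} (Φ : YoungFunction) (u : EuclideanSpace ℝ (Fin n) → ℝ) : ℝ :=
  sInf {k : ℝ | 0 < k ∧ modular Φ u k ≤ 1}

/-- The Orlicz space as a space of a.e. classes of measurable functions. -/
def orliczSubmodule (n : ℕ) (Φ : YoungFunction) :
    Submodule ℝ (EuclideanSpace ℝ (Fin n) →ₘ[volume] ℝ) where
  carrier := {u | ∃ k : ℝ, 0 < k ∧ modular Φ u k < ∞}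
  zero_mem' := ⟨1, one_pos, by
    rw [modular_congr Φ (AEEqFun.coeFn_zero (β := ℝ)), modular_zero]; simp⟩
  add_mem' := by
    rintro u v ⟨k, hk, hu⟩ ⟨l, hl, hv⟩
    refine ⟨k + l, by positivity, ?_⟩
    rw [modular_congr Φ (AEEqFun.coeFn_add u v)]
    exact (modular_add Φ u.aemeasurable hk hl).trans_lt
      (ENNReal.add_lt_top.2 ⟨ENNReal.mul_lt_top ENNReal.ofReal_lt_top hu,
        ENNReal.mul_lt_top ENNReal.ofReal_lt_top hv⟩)
  smul_mem' := by
    rintro c u ⟨k, hk, hu⟩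
    rcases eq_or_ne c 0 with rfl | hc
    · refine ⟨1, one_pos, ?_⟩
      rw [zero_smul, modular_congr Φ (AEEqFun.coeFn_zero (β := ℝ)), modular_zero]; simp
    · refine ⟨|c| * k, by positivity, ?_⟩
      rw [modular_congr Φ (AEEqFun.coeFn_smul c u), modular_smul Φ hc]
      exact hu

/-- The Orlicz space `L^Φ(ℝⁿ)`. -/
abbrev Orlicz (n : ℕ) (Φ : YoungFunction) : Type := orliczSubmodule n Φ

namespace Orlicz

variable {n : ℕ} {Φ : YoungFunction}

/-- The underlying function of an element of the Orlicz space. -/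
instance : CoeFun (Orlicz n Φ) (fun _ => EuclideanSpace ℝ (Fin n) → ℝ) :=
  ⟨fun u => (u.1 : EuclideanSpace ℝ (Fin n) →ₘ[volume] ℝ)⟩

instance : Norm (Orlicz n Φ) := ⟨fun u => luxemburg Φ u⟩

theorem norm_def (u : Orlicz n Φ) : ‖u‖ = sInf {k : ℝ | 0 < k ∧ modular Φ u k ≤ 1} := rfl

theorem coeFn_zero : (0 : Orlicz n Φ) =ᵐ[volume] (0 : EuclideanSpace ℝ (Fin n) → ℝ) :=
  AEEqFun.coeFn_zero

theorem coeFn_add (u v : Orlicz n Φ) : (u + v : Orlicz n Φ) =ᵐ[volume] (⇑u.1 + ⇑v.1) :=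
  AEEqFun.coeFn_add u.1 v.1

theorem coeFn_smul (c : ℝ) (u : Orlicz n Φ) : (c • u : Orlicz n Φ) =ᵐ[volume] (c • ⇑u.1) :=
  AEEqFun.coeFn_smul c u.1

theorem bddBelow (u : Orlicz n Φ) : BddBelow {k : ℝ | 0 < k ∧ modular Φ u k ≤ 1} :=
  ⟨0, fun _ hk => hk.1.le⟩

theorem norm_nonneg' (u : Orlicz n Φ) : 0 ≤ ‖u‖ := Real.sInf_nonneg fun _ hk => hk.1.le

theorem norm_le_of_modular {u : Orlicz n Φ} {k : ℝ} (hk : 0 < k) (h : modular Φ u k ≤ 1) :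
    ‖u‖ ≤ k := csInf_le u.bddBelow ⟨hk, h⟩

theorem nonempty (u : Orlicz n Φ) : {k : ℝ | 0 < k ∧ modular Φ u k ≤ 1}.Nonempty := by
  obtain ⟨k, hk, h⟩ := u.2
  have hM : 0 < (modular Φ u k).toReal + 1 := by positivity
  refine ⟨k / (1 / ((modular Φ u k).toReal + 1)), by positivity, ?_⟩
  refine (modular_scale Φ (by positivity) ?_ hk).trans ?_
  · rw [div_le_one hM]; linarith [ENNReal.toReal_nonneg (a := modular Φ u k)]
  · rw [← ENNReal.ofReal_toReal h.ne, ← ENNReal.ofReal_mul (by positivity)]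
    refine ENNReal.ofReal_le_one.2 ?_
    rw [ENNReal.toReal_ofReal ENNReal.toReal_nonneg, one_div_mul_eq_div, div_le_one hM]
    linarith

theorem modular_le_one {u : Orlicz n Φ} {k : ℝ} (h : ‖u‖ < k) : modular Φ u k ≤ 1 := by
  obtain ⟨l, hl, hlk⟩ := exists_lt_of_csInf_lt u.nonempty h
  exact (modular_anti Φ hl.1 hlk.le).trans hl.2

theorem norm_smul_le' (c : ℝ) (u : Orlicz n Φ) : ‖c • u‖ ≤ |c| * ‖u‖ := by
  rcases eq_or_ne c 0 with rfl | hc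
  · rw [zero_smul, abs_zero, zero_mul]
    refine le_of_forall_pos_le_add fun ε hε => ?_
    rw [zero_add]
    refine norm_le_of_modular hε ?_
    rw [modular_congr Φ coeFn_zero, modular_zero]; simp
  · have hc' : 0 < |c| := abs_pos.2 hc
    rw [← div_le_iff₀' hc']
    refine le_csInf u.nonempty fun k hk => ?_
    rw [div_le_iff₀' hc']
    refine norm_le_of_modular (mul_pos hc' hk.1) ?_
    rw [modular_congr Φ (coeFn_smul c u), modular_smul Φ hc]
    exact hk.2

theorem eq_zero_of_norm {u : Orlicz n Φ} (h : ‖u‖ = 0) : u = 0 := by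
  obtain ⟨r, hr, hΦ⟩ := Φ.exists_pos
  -- the modular vanishes at every scale
  have h0 : ∀ k : ℝ, 0 < k → modular Φ u k = 0 := by
    intro k hk
    refine le_antisymm (le_of_forall_gt fun ε hε => ?_) zero_le
    obtain ⟨a, ha0, ha⟩ := ENNReal.lt_iff_exists_real_btwn.1 (lt_min hε one_pos)
    have ha1 : 0 < a := ENNReal.ofReal_pos.1 ha.1
    have ha2 : a ≤ 1 := ENNReal.ofReal_le_one.1 (ha.2.le.trans (min_le_right _ _))
    have hs := modular_scale Φ (u := u) (k := k * a) ha1 ha2 (by positivity)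
    rw [mul_div_assoc, div_self ha1.ne', mul_one] at hs
    calc modular Φ u k ≤ ENNReal.ofReal a * modular Φ u (k * a) := hs
      _ ≤ ENNReal.ofReal a * 1 := by gcongr; exact modular_le_one (by rw [h]; positivity)
      _ < ε := by rw [mul_one]; exact ha.2.trans_le (min_le_left _ _)
  have hae : ∀ m : ℕ, ∀ᵐ x, Φ (ENNReal.ofReal (|u x| / (1 / (m + 1)))) = 0 := by
    intro m
    have hm : AEMeasurable fun x => Φ (ENNReal.ofReal (|u x| / (1 / (m + 1 : ℝ)))) :=
      Φ.mono_real.measurable.comp_aemeasurable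
        ((continuous_abs.measurable.comp_aemeasurable u.1.aemeasurable).div_const _)
    exact (lintegral_eq_zero_iff' hm).1 (h0 (1 / (m + 1)) (by positivity))
  refine Subtype.ext (AEEqFun.ext ?_)
  refine EventuallyEq.trans ?_ coeFn_zero.symm
  filter_upwards [ae_all_iff.2 hae] with x hx
  by_contra hne
  have hpos : 0 < |u x| := abs_pos.2 hne
  obtain ⟨m, hm⟩ := exists_nat_gt (r / |u x|)
  have : r ≤ |u x| / (1 / (m + 1)) := by
    rw [div_lt_iff₀ hpos] at hm
    rw [div_div_eq_mul_div, div_one]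
    nlinarith
  exact absurd ((Φ.mono_real this).trans (hx m).le) (not_le.2 hΦ)

theorem core : NormedSpace.Core ℝ (Orlicz n Φ) where
  norm_nonneg := norm_nonneg'
  norm_smul c u := by
    refine le_antisymm (norm_smul_le' c u) ?_
    rcases eq_or_ne c 0 with rfl | hc
    · rw [norm_zero, zero_mul]; exact norm_nonneg' _
    · have h := norm_smul_le' c⁻¹ (c • u)
      rw [inv_smul_smul₀ hc, abs_inv] at h
      rw [Real.norm_eq_abs]
      have hc' : 0 < |c| := abs_pos.2 hc
      calc |c| * ‖u‖ ≤ |c| * (|c|⁻¹ * ‖c • u‖) := by gcongr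
        _ = ‖c • u‖ := by field_simp
  norm_triangle u v := by
    refine le_of_forall_pos_le_add fun ε hε => ?_
    have hu := norm_nonneg' u
    have hv := norm_nonneg' v
    have hk : 0 < ‖u‖ + ε / 2 := by positivity
    have hl : 0 < ‖v‖ + ε / 2 := by positivity
    have : ‖u‖ + ‖v‖ + ε = (‖u‖ + ε / 2) + (‖v‖ + ε / 2) := by ring
    rw [this]
    refine norm_le_of_modular (by positivity) ?_
    rw [modular_congr Φ (coeFn_add u v)]
    refine (modular_add Φ u.1.aemeasurable hk hl).trans ?_
    have h1 : modular Φ u (‖u‖ + ε / 2) ≤ 1 := modular_le_one (by linarith)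
    have h2 : modular Φ v (‖v‖ + ε / 2) ≤ 1 := modular_le_one (by linarith)
    refine (add_le_add (mul_le_mul_right h1 _) (mul_le_mul_right h2 _)).trans ?_
    rw [mul_one, mul_one, ← ENNReal.ofReal_add (by positivity) (by positivity), ← add_div,
      div_self (by positivity), ENNReal.ofReal_one]
  norm_eq_zero_iff u := ⟨eq_zero_of_norm, by
    rintro rfl
    refine le_antisymm ?_ (norm_nonneg' _)
    simpa using norm_smul_le' 0 (0 : Orlicz n Φ)⟩

instance : NormedAddCommGroup (Orlicz n Φ) := NormedAddCommGroup.ofCore core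

instance : NormedSpace ℝ (Orlicz n Φ) := NormedSpace.ofCore core

end Orlicz

/-- `L₀^Φ(ℝⁿ)`: the closure of `C₀^∞(ℝⁿ)` in `L^Φ(ℝⁿ)`. -/
def orliczZero (n : ℕ) (Φ : YoungFunction) : Set (Orlicz n Φ) :=
  closure {u | ∃ g : EuclideanSpace ℝ (Fin n) → ℝ,
    ContDiff ℝ (⊤ : ℕ∞) g ∧ HasCompactSupport g ∧ u =ᵐ[volume] g}

/-- The Morse–Transue space `M^Φ(ℝⁿ)`, with the norm induced from `L^Φ(ℝⁿ)`. -/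
def morseTransue (n : ℕ) (Φ : YoungFunction) : Submodule ℝ (Orlicz n Φ) where
  carrier := {u | ∀ k : ℝ, 0 < k → modular Φ u k < ∞}
  zero_mem' k _ := by rw [modular_congr Φ Orlicz.coeFn_zero, modular_zero]; simp
  add_mem' := by
    intro u v hu hv k hk
    rw [modular_congr Φ (Orlicz.coeFn_add u v), ← add_halves k]
    exact (modular_add Φ u.1.aemeasurable (half_pos hk) (half_pos hk)).trans_lt
      (ENNReal.add_lt_top.2
        ⟨ENNReal.mul_lt_top ENNReal.ofReal_lt_top (hu _ (half_pos hk)),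
          ENNReal.mul_lt_top ENNReal.ofReal_lt_top (hv _ (half_pos hk))⟩)
  smul_mem' := by
    intro c u hu k hk
    rw [modular_congr Φ (Orlicz.coeFn_smul c u)]
    rcases eq_or_ne c 0 with rfl | hc
    · rw [zero_smul, modular_zero]; simp
    · have hc' : 0 < |c| := abs_pos.2 hc
      rw [show k = |c| * (k / |c|) by field_simp, modular_smul Φ hc]
      exact hu _ (by positivity)

/-! ### The heat semigroup -/

/-- The Gaussian heat kernel `G(x, t) = (4πt)^{-n/2} exp(-|x|²/(4t))`. -/
def heatKernel (n : ℕ) (x : EuclideanSpace ℝ (Fin n)) (t : ℝ) : ℝ :=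
  (4 * Real.pi * t) ^ (-(n : ℝ) / 2) * Real.exp (-‖x‖ ^ 2 / (4 * t))

/-- `S(t)φ = G(·, t) * φ` for `t > 0` and `S(0)φ = φ`. -/
def heat (n : ℕ) (t : ℝ) (φ : EuclideanSpace ℝ (Fin n) → ℝ) (x : EuclideanSpace ℝ (Fin n)) : ℝ :=
  if t = 0 then φ x else ∫ y, heatKernel n (x - y) t * φ y

/-- A one-parameter semigroup of bounded linear operators. -/
structure IsOperatorSemigroup {X : Type*} [NormedAddCommGroup X] [NormedSpace ℝ X]
    (S : ℝ≥0 → X →L[ℝ] X) : Prop where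
  map_zero : S 0 = ContinuousLinearMap.id ℝ X
  map_add : ∀ s t, S (s + t) = (S s).comp (S t)

/-- A `C₀`-semigroup: a semigroup of bounded linear operators, strongly continuous at `t = 0`. -/
structure IsC0Semigroup {X : Type*} [NormedAddCommGroup X] [NormedSpace ℝ X]
    (S : ℝ≥0 → X →L[ℝ] X) : Prop extends IsOperatorSemigroup S where
  tendsto_zero : ∀ x, Tendsto (fun t => S t x) (𝓝[>] 0) (𝓝 x)

end

/-! ### Young's functions: growth, Jensen's inequality and generalised inverses. -/

namespace YoungFunction

variable (Φ : YoungFunction)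

/-! Since Φ is convex with Φ(0) = 0, the quotient Φ(x)/x is nondecreasing. This yields Jensen's
inequality up to a factor two in the argument (`half_le_lintegral`), by an argument that applies
equally to extended-valued Φ. Applied to the measure G(x - y, t) dy it bounds Φ(|S(t)φ|/(2k))
pointwise by the heat average of Φ(|φ|/k). Integrating in x, with the kernel of unit mass, gives the
norm bound 2 (`modular_heat_le`). Since the kernel is bounded and Φ is unbounded, the same
inequality gives absolute convergence. The semigroup law is Fubini together with completing the
square in a product of Gaussians.

Strong continuity is checked on test functions g. There S(t)g - g is O(√t) both uniformly and in L¹,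
by the Lipschitz property and the first moment of the kernel. Below a fixed height Φ lies under a
chord, so the two bounds make the modular small at any scale. The uniform operator bound carries
this to the closure (`tendstoUniformlyOn_zero_of_subset_closure`). When Φ is finite, truncation and
mollification put M^Φ inside that closure.

For smoothing, set s = t^(-n/2). The heat average of Φ(|φ|/k) is at most s when the modular is at
most 1. Compatibility makes Ψ⁻¹/Φ⁻¹ nonincreasing up to the factor β, because Θ⁻¹(x)/x is
nonincreasing. Hence, for values v with Φ(v) ≤ s, rescaling v by a multiple of Ψ⁻¹(s)/Φ⁻¹(s) turns Φ
into an upper bound for Ψ (`apply_le_apply_of_compatible`), and the modular bound for Φ becomes one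
for Ψ. The vanishing limit follows by approximation: the weighted norms are uniformly Lipschitz on
L^Φ, and on a test function S(t)g stays bounded in L^Ψ while the weight tends to zero. -/

theorem apply_mul_le {a : ℝ≥0} (ha : a ≤ 1) {x : ℝ≥0∞} (hx : x < ∞) : Φ (a * x) ≤ a * Φ x := by
  have h := Φ.convex hx ENNReal.zero_lt_top a (1 - a) (add_tsub_cancel_of_le ha)
  simpa [Φ.zero'] using h

/-- The quotient `Φ(x)/x` is nondecreasing. -/
theorem apply_mul_le_mul_apply {x y : ℝ≥0∞} (hxy : x ≤ y) (hy : y < ∞) :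
    Φ x * y ≤ x * Φ y := by
  lift y to ℝ≥0 using hy.ne
  lift x to ℝ≥0 using ne_top_of_le_ne_top ENNReal.coe_ne_top hxy
  rcases eq_or_ne y 0 with rfl | hy0
  · simp
  have hxy' : x ≤ y := by exact_mod_cast hxy
  have h := Φ.apply_mul_le (a := x / y) (div_le_one_of_le₀ hxy' zero_le)
    (ENNReal.coe_lt_top (r := y))
  rw [← ENNReal.coe_mul, div_mul_cancel₀ _ hy0] at h
  calc Φ x * y ≤ ((x / y : ℝ≥0) * Φ y) * y := by gcongr
    _ = ((x / y : ℝ≥0) * y : ℝ≥0∞) * Φ y := by ring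
    _ = x * Φ y := by rw [← ENNReal.coe_mul, div_mul_cancel₀ _ hy0]

theorem exists_finite : ∃ x : ℝ, 0 < x ∧ Φ (ENNReal.ofReal x) < ∞ := by
  have key : ∃ x : ℝ≥0∞, 0 < x ∧ x < ∞ ∧ Φ x < ∞ := by
    rcases Φ.young' with h | ⟨b, hb0, hb, -, -, h, -⟩ | ⟨b, hb0, hb, -, -, h, -, -⟩
    · exact ⟨1, one_pos, ENNReal.one_lt_top, h.2.2.1 1 ENNReal.one_lt_top⟩
    · exact ⟨b, hb0, hb, h b (mem_Iic.2 le_rfl)⟩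
    · obtain ⟨x, hx0, hx⟩ := exists_between hb0
      exact ⟨x, hx0, hx.trans hb, h x hx⟩
  obtain ⟨x, hx0, hx, h⟩ := key
  exact ⟨x.toReal, ENNReal.toReal_pos hx0.ne' hx.ne, by rwa [ENNReal.ofReal_toReal hx.ne]⟩

/-- One positive value forces at least linear growth, because Φ(x)/x is nondecreasing; large
multiples of that point then suffice. -/
theorem exists_lt_apply {M : ℝ≥0∞} (hM : M < ∞) : ∃ x : ℝ≥0, 0 < x ∧ M < Φ x := by
  obtain ⟨r, hr, hΦ⟩ := Φ.exists_pos
  set x : ℝ≥0 := r.toNNReal with hx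
  have hx0 : 0 < x := by simpa [hx] using hr
  have hΦ' : 0 < Φ x := hΦ
  have hlim : ∃ N : ℕ, M < N * Φ x := by
    rcases eq_or_ne (Φ x) ∞ with h | h
    · exact ⟨1, by simpa [h] using hM⟩
    · obtain ⟨N, hN⟩ := ENNReal.exists_nat_gt (ENNReal.div_lt_top hM.ne hΦ'.ne').ne
      exact ⟨N, (ENNReal.div_lt_iff (Or.inl hΦ'.ne') (Or.inl h)).1 hN⟩
  obtain ⟨N, hN⟩ := hlim
  have hN' : M < (N + 1 : ℕ) * Φ x := hN.trans_le (by gcongr; simp)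
  refine ⟨(N + 1 : ℕ) * x, by positivity, hN'.trans_le ?_⟩
  have h := Φ.apply_mul_le_mul_apply (x := x) (y := ((N + 1 : ℕ) * x : ℝ≥0))
    (by norm_cast; exact le_mul_of_one_le_left zero_le (by simp)) ENNReal.coe_lt_top
  have hx0' : (x : ℝ≥0∞) ≠ 0 := by simpa using hx0.ne'
  rw [ENNReal.coe_mul, ← mul_assoc, mul_comm (Φ x * _), ENNReal.mul_le_mul_iff_right hx0'
    ENNReal.coe_ne_top] at h
  rw [mul_comm]
  simpa [mul_comm] using h

/-- A form of Jensen's inequality with a loss of a factor two in the argument. -/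
theorem half_le_lintegral {α : Type*} [MeasurableSpace α] {μ : Measure α} (hμ : μ univ ≤ 1)
    {f : α → ℝ≥0∞} (hf : Measurable f) (hf' : ∀ x, f x < ∞)
    {m : ℝ≥0∞} (hm : m < ∞) (hmf : m ≤ ∫⁻ x, f x ∂μ) : Φ (m / 2) ≤ ∫⁻ x, Φ (f x) ∂μ := by
  rcases eq_or_ne m 0 with rfl | hm0
  · simp [Φ.zero']
  have h0 : m / 2 ≠ 0 := by simpa using hm0
  have h1 : m / 2 ≠ ∞ := (ENNReal.div_lt_top hm.ne two_ne_zero).ne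
  rw [← ENNReal.mul_le_mul_iff_right h0 h1]
  -- As the mass is at most 1, subtracting m/2 from f costs at most m/2, so the remaining integral
  -- is at least m/2. Only the points with f ≥ m/2 contribute, and there monotonicity of Φ(x)/x
  -- replaces the supporting line of the usual proof.
  calc m / 2 * Φ (m / 2) ≤ Φ (m / 2) * ∫⁻ x, (f x - m / 2) ∂μ := by
        rw [mul_comm]
        gcongr
        calc m / 2 = m - m / 2 := (ENNReal.sub_half hm.ne).symm
          _ ≤ ∫⁻ x, f x ∂μ - ∫⁻ _, m / 2 ∂μ := by
              refine tsub_le_tsub hmf ?_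
              rw [lintegral_const]
              exact mul_le_of_le_one_right zero_le hμ
          _ ≤ _ := lintegral_sub_le _ _ measurable_const
    _ = ∫⁻ x, Φ (m / 2) * (f x - m / 2) ∂μ := by
        rw [lintegral_const_mul _ (hf.sub_const _)]
    _ ≤ ∫⁻ x, m / 2 * Φ (f x) ∂μ := by
        refine lintegral_mono fun x => ?_
        rcases le_total (m / 2) (f x) with h | h
        · exact (mul_le_mul_right tsub_le_self _).trans (Φ.apply_mul_le_mul_apply h (hf' x))
        · simp [tsub_eq_zero_of_le h]
    _ = _ := lintegral_const_mul' _ _ h1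

/-- If f had infinite integral, Jensen would hold with every finite m and bound Φ everywhere by the
finite integral of Φ(f), contradicting unboundedness. -/
theorem lintegral_lt_top {α : Type*} [MeasurableSpace α] {μ : Measure α} (hμ : μ univ ≤ 1)
    {f : α → ℝ≥0∞} (hf : Measurable f) (hf' : ∀ x, f x < ∞)
    (h : ∫⁻ x, Φ (f x) ∂μ < ∞) : ∫⁻ x, f x ∂μ < ∞ := by
  by_contra hcon
  rw [not_lt, top_le_iff] at hcon
  obtain ⟨x, -, hx⟩ := Φ.exists_lt_apply h
  have := Φ.half_le_lintegral hμ hf hf' (m := x * 2) (by finiteness) (by simp [hcon])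
  rw [ENNReal.mul_div_cancel_right two_ne_zero (by simp)] at this
  exact absurd hx (not_lt.2 this)

theorem inv_lt_top {y : ℝ≥0∞} (hy : y < ∞) : Φ.inv y < ∞ := by
  obtain ⟨x, hx0, hx⟩ := Φ.exists_lt_apply hy
  exact lt_of_le_of_lt (sInf_le ⟨by exact_mod_cast hx0, hx⟩) (ENNReal.coe_lt_top (r := x))

theorem le_inv {a p : ℝ≥0∞} (ha : a < ∞) (h : Φ a ≤ p) : a ≤ Φ.inv p := by
  refine le_sInf fun x hx => ?_
  by_contra hcon
  exact absurd (hx.2.trans_le ((Φ.mono (not_le.1 hcon).le ha).trans h)) (lt_irrefl _)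

/-- Strictness matters: a function of type (II) may jump upwards at its endpoint b, so Φ(Φ⁻¹(p)) can
exceed p. This is the source of the second factor two in the smoothing constant. -/
theorem apply_le_of_lt_inv {a p : ℝ≥0∞} (h : a < Φ.inv p) : Φ a ≤ p := by
  rcases eq_or_ne a 0 with rfl | ha
  · simp [Φ.zero']
  by_contra hcon
  exact absurd (h.trans_le (sInf_le ⟨pos_iff_ne_zero.2 ha, not_le.1 hcon⟩)) (lt_irrefl _)

theorem exists_pos_apply_le {p : ℝ≥0∞} (hp : 0 < p) : ∃ x : ℝ≥0, 0 < x ∧ Φ x ≤ p := by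
  obtain ⟨r, hr, hΦ⟩ := Φ.exists_finite
  set x : ℝ≥0 := r.toNNReal with hx
  have hx0 : 0 < x := by simpa [hx] using hr
  have hΦ' : Φ x < ∞ := hΦ
  obtain ⟨N, hN⟩ := ENNReal.exists_nat_mul_gt hp.ne' hΦ'.ne
  have hN0 : (0 : ℝ≥0) < N + 1 := by positivity
  refine ⟨(N + 1 : ℝ≥0)⁻¹ * x, by positivity, ?_⟩
  have h := Φ.apply_mul_le (a := (N + 1 : ℝ≥0)⁻¹) (inv_le_one_of_one_le₀ (by simp))
    (ENNReal.coe_lt_top (r := x))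
  rw [ENNReal.coe_mul]
  refine h.trans ?_
  rw [ENNReal.coe_inv hN0.ne', mul_comm, ← div_eq_mul_inv]
  refine ENNReal.div_le_of_le_mul' (hN.le.trans ?_)
  gcongr
  simp

theorem inv_pos {p : ℝ≥0∞} (hp : 0 < p) : 0 < Φ.inv p := by
  obtain ⟨x, hx0, hx⟩ := Φ.exists_pos_apply_le hp
  exact lt_of_lt_of_le (by exact_mod_cast hx0) (Φ.le_inv (ENNReal.coe_lt_top (r := x)) hx)

/-- The quotient `Φ⁻¹(y)/y` is nonincreasing. -/
theorem mul_inv_le_mul_inv {p s : ℝ≥0} (hp : 0 < p) (hps : p ≤ s) :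
    p * Φ.inv s ≤ s * Φ.inv p := by
  have hs : 0 < s := hp.trans_le hps
  have hp' : (p : ℝ≥0∞) ≠ 0 := by simpa using hp.ne'
  have hs' : (s : ℝ≥0∞) ≠ 0 := by simpa using hs.ne'
  rw [mul_comm, ← ENNReal.le_div_iff_mul_le (Or.inl hp') (Or.inl ENNReal.coe_ne_top),
    ENNReal.mul_div_right_comm, mul_comm,
    ← ENNReal.div_le_iff (ENNReal.div_pos hs' ENNReal.coe_ne_top).ne'
      (ENNReal.div_lt_top ENNReal.coe_ne_top hp').ne]
  refine le_sInf fun x hx => ?_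
  rw [ENNReal.div_le_iff (ENNReal.div_pos hs' ENNReal.coe_ne_top).ne'
      (ENNReal.div_lt_top ENNReal.coe_ne_top hp').ne]
  rcases eq_or_ne x ∞ with rfl | hxt
  · simp [hs']
  lift x to ℝ≥0 using hxt
  rw [← ENNReal.coe_div hp.ne', ← ENNReal.coe_mul]
  have hx0 : 0 < x := by exact_mod_cast hx.1
  -- If x competes in the infimum for p, then (s/p)x competes in the one for s: otherwise Φ(x) ≤
  -- (p/s) Φ((s/p)x) ≤ p.
  refine sInf_le ⟨by exact_mod_cast mul_pos hx0 (div_pos hs hp), ?_⟩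
  have h := Φ.apply_mul_le (a := p / s) (div_le_one_of_le₀ hps zero_le)
    (ENNReal.coe_lt_top (r := x * (s / p)))
  rw [← ENNReal.coe_mul, show p / s * (x * (s / p)) = x by field_simp] at h
  by_contra hcon
  have : Φ x ≤ p := h.trans <| by
    calc ((p / s : ℝ≥0) : ℝ≥0∞) * _ ≤ (p / s : ℝ≥0) * s := by gcongr; exact not_lt.1 hcon
      _ = p := by rw [← ENNReal.coe_mul, div_mul_cancel₀ _ hs.ne']
  exact absurd hx.2 (not_lt.2 this)

/-- Compatibility makes `Ψ⁻¹/Φ⁻¹` almost nonincreasing. -/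
theorem inv_mul_inv_le {Φ Ψ Θ : YoungFunction} {β : ℝ≥0}
    (h : ∀ x : ℝ≥0, β * x * Ψ.inv x ≤ Φ.inv x * Θ.inv x ∧ Φ.inv x * Θ.inv x ≤ x * Ψ.inv x)
    {p s : ℝ≥0} (hp : 0 < p) (hps : p ≤ s) :
    β * Ψ.inv s * Φ.inv p ≤ Ψ.inv p * Φ.inv s := by
  have hs : 0 < s := hp.trans_le hps
  have hps0 : ((p * s : ℝ≥0) : ℝ≥0∞) ≠ 0 := by simp [hp.ne', hs.ne']
  rw [← ENNReal.mul_le_mul_iff_right hps0 ENNReal.coe_ne_top]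
  -- Divided out, the chain is βΨ⁻¹(s)/Φ⁻¹(s) ≤ Θ⁻¹(s)/s ≤ Θ⁻¹(p)/p ≤ Ψ⁻¹(p)/Φ⁻¹(p): the lower half
  -- of compatibility at s, the upper half at p.
  calc ((p * s : ℝ≥0) : ℝ≥0∞) * (β * Ψ.inv s * Φ.inv p)
      = p * Φ.inv p * (β * s * Ψ.inv s) := by push_cast; ring
    _ ≤ p * Φ.inv p * (Φ.inv s * Θ.inv s) := mul_le_mul_right (h s).1 _
    _ = Φ.inv p * Φ.inv s * (p * Θ.inv s) := by ring
    _ ≤ Φ.inv p * Φ.inv s * (s * Θ.inv p) := mul_le_mul_right (Θ.mul_inv_le_mul_inv hp hps) _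
    _ = s * Φ.inv s * (Φ.inv p * Θ.inv p) := by ring
    _ ≤ s * Φ.inv s * (p * Ψ.inv p) := mul_le_mul_right (h p).2 _
    _ = _ := by push_cast; ring

/-- The pointwise comparison behind the smoothing estimate. -/
theorem apply_le_apply_of_compatible {Φ Ψ Θ : YoungFunction} {β : ℝ≥0}
    (h : ∀ x : ℝ≥0, β * x * Ψ.inv x ≤ Φ.inv x * Θ.inv x ∧ Φ.inv x * Θ.inv x ≤ x * Ψ.inv x)
    {s : ℝ≥0} (hs : 0 < s) {v w : ℝ≥0∞} (hv : v < ∞) (hvs : Φ v ≤ s)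
    (hw : 2 * w * Φ.inv s ≤ β * v * Ψ.inv s) : Ψ w ≤ Φ v := by
  -- Here v ≤ Φ⁻¹(p), so moving the ratio from s down to p gives 2w ≤ Ψ⁻¹(p). The 2 provides the
  -- strict inequality needed to return from Ψ⁻¹ to Ψ.
  have key : ∀ p : ℝ≥0, 0 < p → p ≤ s → Φ v ≤ p → Ψ w ≤ p := by
    intro p hp hps hvp
    refine Ψ.apply_le_of_lt_inv ?_
    have hs0 : Φ.inv s ≠ 0 := (Φ.inv_pos (by exact_mod_cast hs)).ne'
    have hst : Φ.inv s ≠ ∞ := (Φ.inv_lt_top ENNReal.coe_lt_top).ne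
    have hp0 : Ψ.inv p ≠ 0 := (Ψ.inv_pos (by exact_mod_cast hp)).ne'
    have hpt : Ψ.inv p ≠ ∞ := (Ψ.inv_lt_top ENNReal.coe_lt_top).ne
    have h1 : 2 * w * Φ.inv s ≤ Ψ.inv p * Φ.inv s := by
      refine hw.trans (le_trans ?_ (inv_mul_inv_le h hp hps))
      rw [mul_right_comm]
      gcongr
      exact Φ.le_inv hv hvp
    rw [ENNReal.mul_le_mul_iff_left hs0 hst] at h1
    calc w ≤ Ψ.inv p / 2 := by
          rw [ENNReal.le_div_iff_mul_le (Or.inl two_ne_zero) (Or.inl (by simp)), mul_comm]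
          exact h1
      _ < Ψ.inv p := ENNReal.half_lt_self hp0 hpt
  have hvt : Φ v ≠ ∞ := ne_top_of_le_ne_top ENNReal.coe_ne_top hvs
  -- The choice p = Φ(v) is available only when it is positive; if it vanishes, p is sent to zero.
  rcases eq_or_ne (Φ v) 0 with h0 | h0
  · rw [h0]
    refine ENNReal.le_of_forall_pos_le_add fun ε hε _ => ?_
    rw [zero_add]
    exact (key (min ε s) (lt_min hε hs) (min_le_right _ _) (by simp [h0])).trans
      (by exact_mod_cast min_le_left _ _)
  · have := key (Φ v).toNNReal (ENNReal.toNNReal_pos h0 hvt)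
      (ENNReal.toNNReal_mono ENNReal.coe_ne_top hvs) (by rw [ENNReal.coe_toNNReal hvt])
    rwa [ENNReal.coe_toNNReal hvt] at this

end YoungFunction

/-! ### The Gaussian kernel: height, mass, convolution and first moment. -/

section heatKernel

variable {n : ℕ} {s t : ℝ}

theorem heatKernel_nonneg (x : EuclideanSpace ℝ (Fin n)) (ht : 0 < t) : 0 ≤ heatKernel n x t := by
  unfold heatKernel; positivity

/-- Discarding 4π leaves exactly the quantity t^(-n/2) at which the inverses are evaluated in the
smoothing estimate. -/
theorem heatKernel_le (x : EuclideanSpace ℝ (Fin n)) (ht : 0 < t) :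
    heatKernel n x t ≤ t ^ (-(n : ℝ) / 2) := by
  have h1 : (4 * Real.pi * t) ^ (-(n : ℝ) / 2) ≤ t ^ (-(n : ℝ) / 2) := by
    refine Real.rpow_le_rpow_of_nonpos ht ?_ ?_
    · nlinarith [Real.pi_gt_three]
    · rw [neg_div]; exact neg_nonpos.2 (by positivity)
  have h2 : Real.exp (-‖x‖ ^ 2 / (4 * t)) ≤ 1 := by
    rw [Real.exp_le_one_iff, neg_div]; exact neg_nonpos.2 (by positivity)
  calc heatKernel n x t ≤ t ^ (-(n : ℝ) / 2) * 1 := by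
        unfold heatKernel; gcongr
    _ = _ := mul_one _

theorem continuous_heatKernel : Continuous fun x => heatKernel n x t := by
  unfold heatKernel; fun_prop

theorem integral_heatKernel (ht : 0 < t) : ∫ x, heatKernel n x t = 1 := by
  have h := GaussianFourier.integral_rexp_neg_mul_sq_norm
    (V := EuclideanSpace ℝ (Fin n)) (b := 1 / (4 * t)) (by positivity)
  have h' : ∀ x : EuclideanSpace ℝ (Fin n),
      heatKernel n x t =
        (4 * Real.pi * t) ^ (-(n : ℝ) / 2) * Real.exp (-(1 / (4 * t)) * ‖x‖ ^ 2) := by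
    intro x; unfold heatKernel; congr 2; ring
  simp_rw [h', integral_const_mul, h, finrank_euclideanSpace_fin]
  rw [show Real.pi / (1 / (4 * t)) = 4 * Real.pi * t by field_simp,
    ← Real.rpow_add (by positivity)]
  simp [neg_div]

theorem integrable_heatKernel (ht : 0 < t) : Integrable fun x => heatKernel n x t :=
  Integrable.of_integral_ne_zero (by rw [integral_heatKernel ht]; exact one_ne_zero)

theorem lintegral_heatKernel (ht : 0 < t) :
    ∫⁻ x, ENNReal.ofReal (heatKernel n x t) = 1 := by
  rw [← ofReal_integral_eq_lintegral_ofReal (integrable_heatKernel ht)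
    (Eventually.of_forall fun x => heatKernel_nonneg x ht), integral_heatKernel ht,
    ENNReal.ofReal_one]

theorem lintegral_heatKernel_sub_left (ht : 0 < t) (x : EuclideanSpace ℝ (Fin n)) :
    ∫⁻ y, ENNReal.ofReal (heatKernel n (x - y) t) = 1 := by
  rw [lintegral_sub_left_eq_self (fun y => ENNReal.ofReal (heatKernel n y t)) x,
    lintegral_heatKernel ht]

theorem lintegral_heatKernel_sub_right (ht : 0 < t) (y : EuclideanSpace ℝ (Fin n)) :
    ∫⁻ x, ENNReal.ofReal (heatKernel n (x - y) t) = 1 := by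
  rw [lintegral_sub_right_eq_self (fun y => ENNReal.ofReal (heatKernel n y t)) y,
    lintegral_heatKernel ht]

theorem measurable_ofReal_heatKernel_sub (x : EuclideanSpace ℝ (Fin n)) :
    Measurable fun y => ENNReal.ofReal (heatKernel n (x - y) t) :=
  (continuous_heatKernel.comp (continuous_const.sub continuous_id)).measurable.ennreal_ofReal

/-- Completing the square in a product of two heat kernels. -/
theorem heatKernel_mul_heatKernel (hs : 0 < s) (ht : 0 < t) (x y : EuclideanSpace ℝ (Fin n)) :
    heatKernel n (x - y) s * heatKernel n y t =
      heatKernel n x (s + t) * heatKernel n (y - (t / (s + t)) • x) (s * t / (s + t)) := by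
  have hst : 0 < s + t := by positivity
  have h1 : (4 * Real.pi * s) ^ (-(n : ℝ) / 2) * (4 * Real.pi * t) ^ (-(n : ℝ) / 2) =
      (4 * Real.pi * (s + t)) ^ (-(n : ℝ) / 2) *
        (4 * Real.pi * (s * t / (s + t))) ^ (-(n : ℝ) / 2) := by
    rw [← Real.mul_rpow (by positivity) (by positivity),
      ← Real.mul_rpow (by positivity) (by positivity)]
    congr 1
    field_simp
  have h2 : Real.exp (-‖x - y‖ ^ 2 / (4 * s)) * Real.exp (-‖y‖ ^ 2 / (4 * t)) =
      Real.exp (-‖x‖ ^ 2 / (4 * (s + t))) *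
        Real.exp (-‖y - (t / (s + t)) • x‖ ^ 2 / (4 * (s * t / (s + t)))) := by
    rw [← Real.exp_add, ← Real.exp_add]
    congr 1
    rw [norm_sub_sq_real, norm_sub_sq_real, norm_smul, inner_smul_right, real_inner_comm y x,
      Real.norm_eq_abs, mul_pow, sq_abs]
    field_simp
    ring
  unfold heatKernel
  rw [mul_mul_mul_comm, h1, h2, mul_mul_mul_comm]

/-- After a translation by z, completing the square leaves one factor depending on y, a shifted
kernel of unit mass. -/
theorem integral_heatKernel_mul (hs : 0 < s) (ht : 0 < t) (x z : EuclideanSpace ℝ (Fin n)) :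
    ∫ y, heatKernel n (x - y) s * heatKernel n (y - z) t = heatKernel n (x - z) (s + t) := by
  have hst : 0 < s * t / (s + t) := by positivity
  have h : ∀ y, heatKernel n (x - y) s * heatKernel n (y - z) t =
      heatKernel n (x - z) (s + t) *
        heatKernel n (y - (z + (t / (s + t)) • (x - z))) (s * t / (s + t)) := by
    intro y
    have := heatKernel_mul_heatKernel hs ht (x - z) (y - z)
    rwa [sub_sub_sub_cancel_right, sub_sub] at this
  simp_rw [h, integral_const_mul]
  rw [integral_sub_right_eq_self (fun y => heatKernel n y (s * t / (s + t))),
    integral_heatKernel hst, mul_one]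

theorem lintegral_heatKernel_mul (hs : 0 < s) (ht : 0 < t) (x z : EuclideanSpace ℝ (Fin n)) :
    ∫⁻ y, ENNReal.ofReal (heatKernel n (x - y) s) * ENNReal.ofReal (heatKernel n (y - z) t) =
      ENNReal.ofReal (heatKernel n (x - z) (s + t)) := by
  simp_rw [← ENNReal.ofReal_mul (heatKernel_nonneg _ hs)]
  rw [← ofReal_integral_eq_lintegral_ofReal, integral_heatKernel_mul hs ht]
  · refine Integrable.of_integral_ne_zero ?_
    rw [integral_heatKernel_mul hs ht]
    unfold heatKernel
    positivity
  · exact Eventually.of_forall fun y => mul_nonneg (heatKernel_nonneg _ hs) (heatKernel_nonneg _ ht)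

/-- The first moment of the heat kernel is of order `√t`. -/
theorem norm_mul_heatKernel_le (ht : 0 < t) (x : EuclideanSpace ℝ (Fin n)) :
    ‖x‖ * heatKernel n x t ≤ 2 * √t * 2 ^ ((n : ℝ) / 2) * heatKernel n x (2 * t) := by
  have h1 : (4 * Real.pi * t) ^ (-(n : ℝ) / 2) =
      2 ^ ((n : ℝ) / 2) * (4 * Real.pi * (2 * t)) ^ (-(n : ℝ) / 2) := by
    rw [show 4 * Real.pi * (2 * t) = 2 * (4 * Real.pi * t) by ring,
      Real.mul_rpow (x := 2) (by positivity) (by positivity), ← mul_assoc,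
      ← Real.rpow_add (by positivity)]
    simp [neg_div]
  -- With r = |x|/√t this is r ≤ 2(1 + r²/8) ≤ 2 exp(r²/8). Half of the Gaussian exponent pays for
  -- it, which leaves the kernel at time 2t.
  have h2 : ‖x‖ ≤ 2 * √t * Real.exp (‖x‖ ^ 2 / (8 * t)) := by
    have hst : 0 < √t := Real.sqrt_pos.2 ht
    have h := Real.add_one_le_exp (‖x‖ ^ 2 / (8 * t))
    have hr : ‖x‖ = √t * (‖x‖ / √t) := by field_simp
    have hq : ‖x‖ ^ 2 / (8 * t) = (‖x‖ / √t) ^ 2 / 8 := by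
      rw [div_pow, Real.sq_sqrt ht.le]; field_simp
    rw [hq] at h ⊢
    calc ‖x‖ = √t * (‖x‖ / √t) := hr
      _ ≤ √t * (2 * Real.exp ((‖x‖ / √t) ^ 2 / 8)) := by
          gcongr
          nlinarith [sq_nonneg (‖x‖ / √t - 2)]
      _ = _ := by ring
  unfold heatKernel
  rw [h1]
  calc ‖x‖ * (2 ^ ((n : ℝ) / 2) * (4 * Real.pi * (2 * t)) ^ (-(n : ℝ) / 2) *
        Real.exp (-‖x‖ ^ 2 / (4 * t)))
      ≤ (2 * √t * Real.exp (‖x‖ ^ 2 / (8 * t))) *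
        (2 ^ ((n : ℝ) / 2) * (4 * Real.pi * (2 * t)) ^ (-(n : ℝ) / 2) *
        Real.exp (-‖x‖ ^ 2 / (4 * t))) := by gcongr
    _ = 2 * √t * 2 ^ ((n : ℝ) / 2) * ((4 * Real.pi * (2 * t)) ^ (-(n : ℝ) / 2) *
        (Real.exp (‖x‖ ^ 2 / (8 * t)) * Real.exp (-‖x‖ ^ 2 / (4 * t)))) := by ring
    _ = _ := by
        rw [← Real.exp_add]
        congr 4
        field_simp
        ring

theorem lintegral_norm_mul_heatKernel_le (ht : 0 < t) :
    ∫⁻ x : EuclideanSpace ℝ (Fin n), ENNReal.ofReal (‖x‖ * heatKernel n x t) ≤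
      ENNReal.ofReal (2 * √t * 2 ^ ((n : ℝ) / 2)) := by
  calc _ ≤ ∫⁻ x : EuclideanSpace ℝ (Fin n),
        ENNReal.ofReal (2 * √t * 2 ^ ((n : ℝ) / 2)) * ENNReal.ofReal (heatKernel n x (2 * t)) := by
        refine lintegral_mono fun x => ?_
        rw [← ENNReal.ofReal_mul (by positivity)]
        exact ENNReal.ofReal_le_ofReal (norm_mul_heatKernel_le ht x)
    _ = _ := by
        rw [lintegral_const_mul' _ _ ENNReal.ofReal_ne_top, lintegral_heatKernel (by positivity),
          mul_one]

end heatKernel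

/-! ### The heat operator on functions with finite modular. -/

section heat

variable {n : ℕ} {s t : ℝ} {φ ψ : EuclideanSpace ℝ (Fin n) → ℝ}

theorem heat_of_pos (ht : 0 < t) (x : EuclideanSpace ℝ (Fin n)) :
    heat n t φ x = ∫ y, heatKernel n (x - y) t * φ y := if_neg ht.ne'

theorem heat_zero : heat n 0 φ = φ := by
  ext x
  exact if_pos rfl

theorem heat_congr (ht : 0 < t) (h : φ =ᵐ[volume] ψ) : heat n t φ = heat n t ψ := by
  ext x
  rw [heat_of_pos ht, heat_of_pos ht]
  refine integral_congr_ae ?_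
  filter_upwards [h] with y hy
  rw [hy]

theorem ofReal_abs_heat_le (ht : 0 < t) (x : EuclideanSpace ℝ (Fin n)) :
    ENNReal.ofReal |heat n t φ x| ≤
      ∫⁻ y, ENNReal.ofReal (heatKernel n (x - y) t) * ENNReal.ofReal |φ y| := by
  rw [heat_of_pos ht, ← Real.norm_eq_abs, ofReal_norm]
  refine (enorm_integral_le_lintegral_enorm _).trans (lintegral_mono fun y => ?_)
  rw [← ofReal_norm, norm_mul, Real.norm_of_nonneg (heatKernel_nonneg _ ht),
    ENNReal.ofReal_mul (heatKernel_nonneg _ ht), Real.norm_eq_abs]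

theorem stronglyMeasurable_heat (hφ : StronglyMeasurable φ) : StronglyMeasurable (heat n t φ) := by
  unfold heat
  split_ifs
  · exact hφ
  · have hc : Continuous fun p : EuclideanSpace ℝ (Fin n) × EuclideanSpace ℝ (Fin n) =>
        heatKernel n (p.1 - p.2) t := continuous_heatKernel.comp (continuous_fst.sub continuous_snd)
    exact (hc.stronglyMeasurable.mul (hφ.comp_measurable measurable_snd)).integral_prod_right

theorem measurable_apply_abs_div (Φ : YoungFunction) (hφ : Measurable φ) (k : ℝ) :
    Measurable fun y => Φ (ENNReal.ofReal (|φ y| / k)) :=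
  Φ.mono_real.measurable.comp ((continuous_abs.measurable.comp hφ).div_const k)

theorem lintegral_withDensity_heatKernel (x : EuclideanSpace ℝ (Fin n))
    {f : EuclideanSpace ℝ (Fin n) → ℝ≥0∞} (hf : Measurable f) :
    ∫⁻ y, f y ∂(volume.withDensity fun y => ENNReal.ofReal (heatKernel n (x - y) t)) =
      ∫⁻ y, ENNReal.ofReal (heatKernel n (x - y) t) * f y :=
  lintegral_withDensity_eq_lintegral_mul _ (measurable_ofReal_heatKernel_sub x) hf

theorem withDensity_heatKernel_univ_le (ht : 0 < t) (x : EuclideanSpace ℝ (Fin n)) :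
    (volume.withDensity fun y => ENNReal.ofReal (heatKernel n (x - y) t)) univ ≤ 1 := by
  rw [withDensity_apply _ MeasurableSet.univ, Measure.restrict_univ,
    lintegral_heatKernel_sub_left ht]

theorem lintegral_heatKernel_mul_le_modular (Φ : YoungFunction) (ht : 0 < t) (k : ℝ)
    (x : EuclideanSpace ℝ (Fin n)) :
    ∫⁻ y, ENNReal.ofReal (heatKernel n (x - y) t) * Φ (ENNReal.ofReal (|φ y| / k)) ≤
      ENNReal.ofReal (t ^ (-(n : ℝ) / 2)) * modular Φ φ k := by
  unfold modular
  rw [← lintegral_const_mul' _ _ ENNReal.ofReal_ne_top]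
  refine lintegral_mono fun y => ?_
  gcongr
  exact heatKernel_le _ ht

/-- Jensen's inequality for the heat semigroup, up to a factor two. -/
theorem apply_heat_le (Φ : YoungFunction) (hφ : Measurable φ) (ht : 0 < t) {k : ℝ} (hk : 0 < k)
    (x : EuclideanSpace ℝ (Fin n)) :
    Φ (ENNReal.ofReal (|heat n t φ x| / (2 * k))) ≤
      ∫⁻ y, ENNReal.ofReal (heatKernel n (x - y) t) * Φ (ENNReal.ofReal (|φ y| / k)) := by
  have hf : Measurable fun y => ENNReal.ofReal (|φ y| / k) :=
    ((continuous_abs.measurable.comp hφ).div_const k).ennreal_ofReal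
  have h := Φ.half_le_lintegral (withDensity_heatKernel_univ_le ht x) hf
    (fun _ => ENNReal.ofReal_lt_top) (m := ENNReal.ofReal (|heat n t φ x| / k))
    ENNReal.ofReal_lt_top ?_
  · rw [lintegral_withDensity_heatKernel x (measurable_apply_abs_div Φ hφ k)] at h
    convert h using 2
    rw [← ENNReal.ofReal_ofNat 2, ← ENNReal.ofReal_div_of_pos two_pos, div_div, mul_comm 2 k]
  · rw [lintegral_withDensity_heatKernel x hf]
    simp_rw [ENNReal.ofReal_div_of_pos hk, div_eq_mul_inv, ← mul_assoc]
    rw [lintegral_mul_const' _ _ (ENNReal.inv_ne_top.2 (ENNReal.ofReal_pos.2 hk).ne')]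
    gcongr
    exact ofReal_abs_heat_le ht x

/-- Boundedness of the kernel makes the average of Φ(|φ|/k) finite at every x, and unboundedness of
Φ passes finiteness on to the average of |φ|. -/
theorem lintegral_heatKernel_mul_abs_lt_top {Φ : YoungFunction} (hφ : Measurable φ) (ht : 0 < t)
    {k : ℝ} (hk : 0 < k) (h : modular Φ φ k < ∞) (x : EuclideanSpace ℝ (Fin n)) :
    ∫⁻ y, ENNReal.ofReal (heatKernel n (x - y) t) * ENNReal.ofReal |φ y| < ∞ := by
  have hf : Measurable fun y => ENNReal.ofReal (|φ y| / k) :=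
    ((continuous_abs.measurable.comp hφ).div_const k).ennreal_ofReal
  have h := Φ.lintegral_lt_top (withDensity_heatKernel_univ_le ht x) hf
    (fun _ => ENNReal.ofReal_lt_top) (by
      rw [lintegral_withDensity_heatKernel x (measurable_apply_abs_div Φ hφ k)]
      exact (lintegral_heatKernel_mul_le_modular Φ ht k x).trans_lt
        (ENNReal.mul_lt_top ENNReal.ofReal_lt_top h))
  rw [lintegral_withDensity_heatKernel x hf] at h
  simp_rw [ENNReal.ofReal_div_of_pos hk, div_eq_mul_inv, ← mul_assoc] at h
  rw [lintegral_mul_const' _ _ (ENNReal.inv_ne_top.2 (ENNReal.ofReal_pos.2 hk).ne')] at h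
  exact lt_of_not_ge fun hcon => by
    rw [top_le_iff.1 hcon, ENNReal.top_mul (ENNReal.inv_ne_zero.2 ENNReal.ofReal_ne_top)] at h
    exact lt_irrefl _ h

/-- Pointwise Jensen, then Tonelli: the kernel also has unit mass in x. -/
theorem modular_heat_le (Φ : YoungFunction) (hφ : Measurable φ) (ht : 0 < t) {k : ℝ}
    (hk : 0 < k) : modular Φ (heat n t φ) (2 * k) ≤ modular Φ φ k := by
  have hc : Continuous fun p : EuclideanSpace ℝ (Fin n) × EuclideanSpace ℝ (Fin n) =>
        heatKernel n (p.1 - p.2) t := continuous_heatKernel.comp (continuous_fst.sub continuous_snd)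
  calc modular Φ (heat n t φ) (2 * k)
      ≤ ∫⁻ x, ∫⁻ y, ENNReal.ofReal (heatKernel n (x - y) t) * Φ (ENNReal.ofReal (|φ y| / k)) :=
        lintegral_mono fun x => apply_heat_le Φ hφ ht hk x
    _ = ∫⁻ y, ∫⁻ x, ENNReal.ofReal (heatKernel n (x - y) t) * Φ (ENNReal.ofReal (|φ y| / k)) := by
        refine lintegral_lintegral_swap (Measurable.aemeasurable ?_)
        exact hc.measurable.ennreal_ofReal.mul
          ((measurable_apply_abs_div Φ hφ k).comp measurable_snd)
    _ = ∫⁻ y, Φ (ENNReal.ofReal (|φ y| / k)) := by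
        refine lintegral_congr fun y => ?_
        rw [lintegral_mul_const, lintegral_heatKernel_sub_right ht, one_mul]
        exact (hc.comp (continuous_id.prodMk continuous_const)).measurable.ennreal_ofReal

theorem integrable_heatKernel_mul {Φ : YoungFunction} (hφ : Measurable φ) (ht : 0 < t) {k : ℝ}
    (hk : 0 < k) (h : modular Φ φ k < ∞) (x : EuclideanSpace ℝ (Fin n)) :
    Integrable fun y => heatKernel n (x - y) t * φ y := by
  refine ⟨(((continuous_heatKernel.comp
    (continuous_const.sub continuous_id)).measurable.mul hφ).aestronglyMeasurable), ?_⟩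
  refine lt_of_eq_of_lt (lintegral_congr fun y => ?_)
    (lintegral_heatKernel_mul_abs_lt_top hφ ht hk h x)
  rw [← ofReal_norm, norm_mul, Real.norm_of_nonneg (heatKernel_nonneg _ ht),
    ENNReal.ofReal_mul (heatKernel_nonneg _ ht), Real.norm_eq_abs]

theorem heat_heat {Φ : YoungFunction} (hφ : Measurable φ) (hs : 0 < s) (ht : 0 < t) {k : ℝ}
    (hk : 0 < k) (h : modular Φ φ k < ∞) (x : EuclideanSpace ℝ (Fin n)) :
    heat n s (heat n t φ) x = heat n (s + t) φ x := by
  have hst : 0 < s + t := by positivity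
  have hc : ∀ r, Continuous fun p : EuclideanSpace ℝ (Fin n) × EuclideanSpace ℝ (Fin n) =>
      heatKernel n (p.1 - p.2) r :=
    fun r => continuous_heatKernel.comp (continuous_fst.sub continuous_snd)
  have hm : Measurable fun p : EuclideanSpace ℝ (Fin n) × EuclideanSpace ℝ (Fin n) =>
      heatKernel n (x - p.1) s * (heatKernel n (p.1 - p.2) t * φ p.2) :=
    ((hc s).comp (continuous_const.prodMk continuous_fst)).measurable.mul
      ((hc t).measurable.mul (hφ.comp measurable_snd))
  -- Integrating |·| in y first collapses the two kernels into the one at time s + t, so joint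
  -- integrability reduces to absolute convergence at that time.
  have hint : Integrable (Function.uncurry fun y z =>
      heatKernel n (x - y) s * (heatKernel n (y - z) t * φ z)) (volume.prod volume) := by
    refine ⟨hm.aestronglyMeasurable, ?_⟩
    refine lt_of_eq_of_lt ((lintegral_prod_symm _ hm.enorm.aemeasurable).trans
      (lintegral_congr fun z => ?_))
      (lintegral_heatKernel_mul_abs_lt_top hφ hst hk h x)
    rw [← lintegral_heatKernel_mul hs ht, ← lintegral_mul_const' _ _ ENNReal.ofReal_ne_top]
    refine lintegral_congr fun y => ?_
    rw [← ofReal_norm, norm_mul, norm_mul, Real.norm_of_nonneg (heatKernel_nonneg _ hs),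
      Real.norm_of_nonneg (heatKernel_nonneg _ ht), Real.norm_eq_abs, ← mul_assoc,
      ENNReal.ofReal_mul (mul_nonneg (heatKernel_nonneg _ hs) (heatKernel_nonneg _ ht)),
      ENNReal.ofReal_mul (heatKernel_nonneg _ hs)]
  rw [heat_of_pos hs, heat_of_pos hst]
  simp_rw [heat_of_pos ht, ← integral_const_mul]
  rw [integral_integral_swap hint]
  refine integral_congr_ae (Eventually.of_forall fun z => ?_)
  simp only
  rw [← integral_heatKernel_mul hs ht, ← integral_mul_const]
  simp_rw [mul_assoc]

theorem heat_add {Φ : YoungFunction} (hφ : Measurable φ) (hψ : Measurable ψ) (ht : 0 ≤ t)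
    {k l : ℝ} (hk : 0 < k) (h : modular Φ φ k < ∞) (hl : 0 < l) (h' : modular Φ ψ l < ∞) :
    heat n t (φ + ψ) = heat n t φ + heat n t ψ := by
  rcases ht.eq_or_lt with rfl | ht
  · simp_rw [heat_zero]
  ext x
  simp only [Pi.add_apply, heat_of_pos ht, mul_add]
  exact integral_add (integrable_heatKernel_mul hφ ht hk h x)
    (integrable_heatKernel_mul hψ ht hl h' x)

theorem heat_smul (c : ℝ) : heat n t (c • φ) = c • heat n t φ := by
  ext x
  unfold heat
  simp only [Pi.smul_apply, smul_eq_mul]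
  split_ifs
  · rfl
  · rw [← integral_const_mul]
    congr 1; ext y; ring

end heat

/-! ### The heat semigroup as bounded operators between Orlicz spaces. -/

namespace Orlicz

variable {n : ℕ} {Φ Ψ : YoungFunction}

/-- The class of a measurable function with a finite modular. -/
noncomputable def ofFun (f : EuclideanSpace ℝ (Fin n) → ℝ) (hf : AEStronglyMeasurable f volume)
    (h : ∃ k : ℝ, 0 < k ∧ modular Φ f k < ∞) : Orlicz n Φ :=
  ⟨AEEqFun.mk f hf, by
    obtain ⟨k, hk, h⟩ := h
    exact ⟨k, hk, by rwa [modular_congr Φ (AEEqFun.coeFn_mk f hf)]⟩⟩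

theorem coeFn_ofFun {f : EuclideanSpace ℝ (Fin n) → ℝ} (hf : AEStronglyMeasurable f volume)
    (h : ∃ k : ℝ, 0 < k ∧ modular Φ f k < ∞) : ofFun f hf h =ᵐ[volume] f :=
  AEEqFun.coeFn_mk f hf

theorem ext_ae {u v : Orlicz n Φ} (h : u =ᵐ[volume] v) : u = v := Subtype.ext (AEEqFun.ext h)

theorem measurable (u : Orlicz n Φ) : Measurable u := u.1.stronglyMeasurable.measurable

theorem coeFn_sub (u v : Orlicz n Φ) : (u - v : Orlicz n Φ) =ᵐ[volume] (⇑u.1 - ⇑v.1) :=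
  AEEqFun.coeFn_sub u.1 v.1

theorem norm_congr {u : Orlicz n Φ} {f : EuclideanSpace ℝ (Fin n) → ℝ} (h : u =ᵐ[volume] f) :
    ‖u‖ = luxemburg Φ f := by
  change luxemburg Φ u = luxemburg Φ f
  simp only [luxemburg, modular_congr Φ h]

theorem norm_le_of_modular_ae {u : Orlicz n Φ} {f : EuclideanSpace ℝ (Fin n) → ℝ}
    (hf : u =ᵐ[volume] f) {k : ℝ} (hk : 0 < k) (h : modular Φ f k ≤ 1) : ‖u‖ ≤ k :=
  norm_le_of_modular hk (by rwa [modular_congr Φ hf])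

/-- Each scale k admissible for u makes ck admissible for v, so the Luxemburg infima compare. -/
theorem norm_le_mul_of_modular {u : Orlicz n Φ} {v : Orlicz n Ψ} {c : ℝ} (hc : 0 < c)
    (h : ∀ k : ℝ, 0 < k → modular Φ u k ≤ 1 → modular Ψ v (c * k) ≤ 1) : ‖v‖ ≤ c * ‖u‖ := by
  rw [← div_le_iff₀' hc]
  refine le_csInf u.nonempty fun k hk => ?_
  rw [div_le_iff₀' hc]
  exact norm_le_of_modular (mul_pos hc hk.1) (h k hk.1 hk.2)

/-- The bounded operator `L^Φ → L^Ψ` given by the heat semigroup at time `t`, under a bound on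
the modulars. -/
noncomputable def heatCLM (Φ Ψ : YoungFunction) (t : ℝ) (ht : 0 ≤ t) (c : ℝ) (hc : 0 < c)
    (h : ∀ φ : EuclideanSpace ℝ (Fin n) → ℝ, Measurable φ → ∀ k : ℝ, 0 < k →
      modular Φ φ k ≤ 1 → modular Ψ (heat n t φ) (c * k) ≤ 1) : Orlicz n Φ →L[ℝ] Orlicz n Ψ :=
  let F : Orlicz n Φ → Orlicz n Ψ := fun u => ofFun (heat n t u)
    (stronglyMeasurable_heat u.1.stronglyMeasurable).aestronglyMeasurable <| by
      obtain ⟨k, hk, hk'⟩ := u.nonempty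
      exact ⟨c * k, mul_pos hc hk, (h u u.measurable k hk hk').trans_lt ENNReal.one_lt_top⟩
  have hF : ∀ u, F u =ᵐ[volume] heat n t u := fun u => coeFn_ofFun _ _
  -- For t > 0 the result does not depend on the representative at any point; at t = 0 the operator
  -- is the identity and only a.e. equality survives.
  have hcongr : ∀ (f g : EuclideanSpace ℝ (Fin n) → ℝ), f =ᵐ[volume] g →
      heat n t f =ᵐ[volume] heat n t g := fun f g hfg => by
    rcases ht.eq_or_lt with rfl | ht
    · rwa [heat_zero, heat_zero]
    · rw [heat_congr ht hfg]
  LinearMap.mkContinuous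
    { toFun := F
      map_add' := fun u v => ext_ae <| by
        refine (hF _).trans ((hcongr _ _ (coeFn_add u v)).trans ?_)
        obtain ⟨k, hk, hk'⟩ := u.2
        obtain ⟨l, hl, hl'⟩ := v.2
        rw [heat_add u.measurable v.measurable ht hk hk' hl hl']
        exact ((hF u).symm.add (hF v).symm).trans (coeFn_add _ _).symm
      map_smul' := fun a u => ext_ae <| by
        refine (hF _).trans ((hcongr _ _ (coeFn_smul a u)).trans ?_)
        rw [heat_smul]
        exact ((hF u).symm.const_smul a).trans (coeFn_smul _ _).symm }
    c fun u => norm_le_mul_of_modular hc fun k hk hk' => by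
      change modular Ψ (F u) (c * k) ≤ 1
      rw [modular_congr Ψ (hF u)]
      exact h u u.measurable k hk hk'

section heatCLM

variable {t : ℝ} {ht : 0 ≤ t} {c : ℝ} {hc : 0 < c}
  {h : ∀ φ : EuclideanSpace ℝ (Fin n) → ℝ, Measurable φ → ∀ k : ℝ, 0 < k →
      modular Φ φ k ≤ 1 → modular Ψ (heat n t φ) (c * k) ≤ 1}

theorem coeFn_heatCLM (u : Orlicz n Φ) : heatCLM Φ Ψ t ht c hc h u =ᵐ[volume] heat n t u :=
  AEEqFun.coeFn_mk (heat n t u)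
    (stronglyMeasurable_heat u.1.stronglyMeasurable).aestronglyMeasurable

theorem norm_heatCLM_le (u : Orlicz n Φ) : ‖heatCLM Φ Ψ t ht c hc h u‖ ≤ c * ‖u‖ :=
  norm_le_mul_of_modular hc fun k hk hk' => by
    rw [modular_congr Ψ (coeFn_heatCLM u)]
    exact h u u.measurable k hk hk'

end heatCLM

/-- The heat semigroup on `L^Φ`. -/
noncomputable def heatSemigroup (n : ℕ) (Φ : YoungFunction) (t : ℝ≥0) :
    Orlicz n Φ →L[ℝ] Orlicz n Φ :=
  heatCLM Φ Φ t t.2 2 two_pos fun φ hφ k hk h => by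
    rcases t.2.eq_or_lt with ht | ht
    · rw [← show (0 : ℝ) = t from ht, heat_zero]
      exact (modular_anti Φ hk (by linarith)).trans h
    · exact (modular_heat_le Φ hφ ht hk).trans h

theorem coeFn_heatSemigroup (t : ℝ≥0) (u : Orlicz n Φ) :
    heatSemigroup n Φ t u =ᵐ[volume] heat n t u := coeFn_heatCLM u

theorem norm_heatSemigroup_le (t : ℝ≥0) (u : Orlicz n Φ) :
    ‖heatSemigroup n Φ t u‖ ≤ 2 * ‖u‖ := norm_heatCLM_le u

theorem heatSemigroup_zero_apply (u : Orlicz n Φ) : heatSemigroup n Φ 0 u = u :=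
  ext_ae <| (coeFn_heatSemigroup 0 u).trans <| by
    rw [NNReal.coe_zero, heat_zero]

theorem isOperatorSemigroup_heatSemigroup : IsOperatorSemigroup (heatSemigroup n Φ) where
  map_zero := by
    ext1 u
    exact heatSemigroup_zero_apply u
  map_add s t := by
    ext1 u
    rcases eq_or_ne s 0 with rfl | hs
    · rw [zero_add, ContinuousLinearMap.comp_apply, heatSemigroup_zero_apply]
    rcases eq_or_ne t 0 with rfl | ht
    · rw [add_zero, ContinuousLinearMap.comp_apply, heatSemigroup_zero_apply]
    have hs' : (0 : ℝ) < s := by exact_mod_cast pos_iff_ne_zero.2 hs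
    have ht' : (0 : ℝ) < t := by exact_mod_cast pos_iff_ne_zero.2 ht
    obtain ⟨k, hk, hk'⟩ := u.2
    refine ext_ae ((coeFn_heatSemigroup _ u).trans ?_)
    rw [ContinuousLinearMap.comp_apply]
    refine EventuallyEq.trans ?_ (coeFn_heatSemigroup s _).symm
    rw [heat_congr hs' (coeFn_heatSemigroup t u)]
    refine Eventually.of_forall fun x => ?_
    rw [heat_heat u.measurable hs' ht' hk hk', NNReal.coe_add]

end Orlicz

/-- A family of functionals that is uniformly Lipschitz in the sense below and tends to zero on a
set `D` tends to zero uniformly on the compact subsets of the closure of `D`. -/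
theorem tendstoUniformlyOn_zero_of_subset_closure {X ι : Type*} [SeminormedAddCommGroup X]
    {l : Filter ι} {F : ι → X → ℝ} {C : ℝ} (hC : 0 < C) {D K : Set X} (hK : IsCompact K)
    (hKD : K ⊆ closure D) (h0 : ∀ᶠ i in l, ∀ x, 0 ≤ F i x)
    (hF : ∀ᶠ i in l, ∀ x y, F i x ≤ F i y + C * ‖x - y‖)
    (hD : ∀ y ∈ D, Tendsto (fun i => F i y) l (𝓝 0)) :
    TendstoUniformlyOn F (fun _ => 0) l K := by
  rw [Metric.tendstoUniformlyOn_iff]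
  intro ε hε
  -- A finite net with centres in D: the radius ε/(2C) makes passing to a centre cost less than ε/2,
  -- leaving ε/2 for the finitely many limits.
  obtain ⟨b, hbD, hb, hKb⟩ := hK.elim_finite_subcover_image (b := D)
    (c := fun y => Metric.ball y (ε / (2 * C))) (fun _ _ => Metric.isOpen_ball) (by
      intro x hx
      obtain ⟨y, hy, hxy⟩ := Metric.mem_closure_iff.1 (hKD hx) (ε / (2 * C)) (by positivity)
      exact mem_biUnion hy hxy)
  have hev : ∀ᶠ i in l, ∀ y ∈ b, F i y < ε / 2 :=
    (eventually_all_finite hb).2 fun y hy => (hD y (hbD hy)).eventually_lt_const (half_pos hε)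
  filter_upwards [h0, hF, hev] with i h0 hF hev x hx
  obtain ⟨y, hy, hxy⟩ := mem_iUnion₂.1 (hKb hx)
  rw [dist_zero_left, Real.norm_of_nonneg (h0 x)]
  rw [Metric.mem_ball, dist_eq_norm, lt_div_iff₀' (by positivity)] at hxy
  linarith [hF x y, hev y hy]

/-! ### Strong continuity at t = 0 on the closure of the test functions. -/

section modular

variable {n : ℕ} {f : EuclideanSpace ℝ (Fin n) → ℝ}

/-- The modular of a small function is controlled by its integral. -/
theorem modular_mul_le (Φ : YoungFunction) {r k : ℝ} (hk : 0 < k)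
    (hΦ : Φ (ENNReal.ofReal r) < ∞) (h : ∀ x, |f x| ≤ k * r) :
    modular Φ f k * ENNReal.ofReal r ≤
      ENNReal.ofReal k⁻¹ * Φ (ENNReal.ofReal r) * ∫⁻ x, ENNReal.ofReal |f x| := by
  unfold modular
  rw [← lintegral_mul_const' _ _ ENNReal.ofReal_ne_top]
  rw [← lintegral_const_mul' _ _ (ENNReal.mul_lt_top ENNReal.ofReal_lt_top hΦ).ne]
  refine lintegral_mono fun x => ?_
  refine (Φ.apply_mul_le_mul_apply (ENNReal.ofReal_le_ofReal ?_) ENNReal.ofReal_lt_top).trans_eq ?_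
  · rw [div_le_iff₀' hk]; exact h x
  · rw [div_eq_mul_inv, ENNReal.ofReal_mul (abs_nonneg _)]; ring

theorem modular_lt_top_of_bounded (Φ : YoungFunction) {M k : ℝ} {K : Set (EuclideanSpace ℝ (Fin n))}
    (hK : MeasurableSet K) (hKv : volume K < ∞) (hM : ∀ x, |f x| ≤ M) (hf : ∀ x ∉ K, f x = 0)
    (hk : 0 < k) (hΦ : Φ (ENNReal.ofReal (M / k)) < ∞) : modular Φ f k < ∞ := by
  calc modular Φ f k ≤ ∫⁻ x, K.indicator (fun _ => Φ (ENNReal.ofReal (M / k))) x := by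
        refine lintegral_mono fun x => ?_
        by_cases hx : x ∈ K
        · rw [indicator_of_mem hx]
          refine Φ.mono_real ?_
          gcongr
          exact hM x
        · simp [hf x hx, Φ.zero']
    _ = Φ (ENNReal.ofReal (M / k)) * volume K := by rw [lintegral_indicator hK, setLIntegral_const]
    _ < ∞ := ENNReal.mul_lt_top hΦ hKv

theorem exists_modular_lt_top (Φ : YoungFunction) (hf : Continuous f) (hfc : HasCompactSupport f) :
    ∃ k : ℝ, 0 < k ∧ modular Φ f k < ∞ := by
  obtain ⟨M, hM⟩ := hfc.exists_bound_of_continuous hf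
  obtain ⟨r, hr, hΦ⟩ := Φ.exists_finite
  have hM0 : 0 ≤ M := (norm_nonneg _).trans (hM 0)
  -- The scale brings the height M + 1 down to r, where Φ is finite; the extra 1 keeps it positive
  -- when M = 0.
  have hk : 0 < (M + 1) / r := by positivity
  refine ⟨(M + 1) / r, hk, modular_lt_top_of_bounded Φ hfc.isCompact.measurableSet
    hfc.isCompact.measure_lt_top (M := M + 1)
    (fun x => (hM x).trans (by linarith)) (fun x hx => image_eq_zero_of_notMem_tsupport hx) hk ?_⟩
  rwa [div_div_cancel₀ (by positivity)]

end modular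

section testFunctions

variable {n : ℕ} {t : ℝ} {g : EuclideanSpace ℝ (Fin n) → ℝ} {L : ℝ≥0}

/-- Unit mass of the kernel lets g(x) be written under the integral, so that S(t)g - g becomes an
average of increments of g. -/
theorem ofReal_abs_heat_sub_le (hg : Continuous g) (hgc : HasCompactSupport g) (ht : 0 < t)
    (x : EuclideanSpace ℝ (Fin n)) :
    ENNReal.ofReal |heat n t g x - g x| ≤
      ∫⁻ y, ENNReal.ofReal (heatKernel n y t) * ENNReal.ofReal |g (x - y) - g x| := by
  have h1 : heat n t g x = ∫ y, heatKernel n y t * g (x - y) := by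
    rw [heat_of_pos ht, ← integral_sub_left_eq_self _ _ x]
    simp_rw [sub_sub_cancel]
  have h2 : g x = ∫ y, heatKernel n y t * g x := by
    rw [integral_mul_const, integral_heatKernel ht, one_mul]
  have hi : Integrable fun y => heatKernel n y t * g (x - y) := by
    obtain ⟨M, hM⟩ := hgc.exists_bound_of_continuous hg
    exact (integrable_heatKernel ht).mul_bdd
      (hg.comp (continuous_const.sub continuous_id)).aestronglyMeasurable
      (Eventually.of_forall fun y => hM (x - y))
  conv_lhs => rw [h2, h1, ← integral_sub hi ((integrable_heatKernel ht).mul_const _)]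
  rw [← Real.norm_eq_abs, ofReal_norm]
  refine (enorm_integral_le_lintegral_enorm _).trans (lintegral_mono fun y => ?_)
  rw [← mul_sub, ← ofReal_norm, norm_mul, Real.norm_of_nonneg (heatKernel_nonneg _ ht),
    ENNReal.ofReal_mul (heatKernel_nonneg _ ht), Real.norm_eq_abs]

theorem abs_heat_sub_le (hg : LipschitzWith L g) (hgc : HasCompactSupport g) (ht : 0 < t)
    (x : EuclideanSpace ℝ (Fin n)) :
    |heat n t g x - g x| ≤ L * (2 * √t * 2 ^ ((n : ℝ) / 2)) := by
  rw [← ENNReal.ofReal_le_ofReal_iff (by positivity), ENNReal.ofReal_mul L.coe_nonneg]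
  refine (ofReal_abs_heat_sub_le hg.continuous hgc ht x).trans
    (le_trans ?_ (mul_le_mul_right (lintegral_norm_mul_heatKernel_le ht) _))
  rw [← lintegral_const_mul' _ _ ENNReal.ofReal_ne_top]
  refine lintegral_mono fun y => ?_
  rw [← ENNReal.ofReal_mul (heatKernel_nonneg _ ht), ← ENNReal.ofReal_mul L.coe_nonneg]
  refine ENNReal.ofReal_le_ofReal ?_
  have h := hg.dist_le_mul (x - y) x
  rw [Real.dist_eq, dist_eq_norm, sub_sub_cancel_left, norm_neg] at h
  calc heatKernel n y t * |g (x - y) - g x| ≤ heatKernel n y t * (L * ‖y‖) := by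
        gcongr; exact heatKernel_nonneg _ ht
    _ = _ := by ring

/-- The increment lives on the support of g and its translate by y, whence the factor 2, and is at
most L|y| there. -/
theorem lintegral_abs_translate_sub_le (hg : LipschitzWith L g) (hgc : HasCompactSupport g)
    (y : EuclideanSpace ℝ (Fin n)) :
    ∫⁻ x, ENNReal.ofReal |g (x - y) - g x| ≤
      2 * volume (tsupport g) * (L * ENNReal.ofReal ‖y‖) := by
  have hm : MeasurableSet (tsupport g) := hgc.isCompact.measurableSet
  set I : EuclideanSpace ℝ (Fin n) → ℝ≥0∞ := (tsupport g).indicator 1 with hI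
  have hIm : Measurable I := measurable_const.indicator hm
  have hIi : ∫⁻ x, I x = volume (tsupport g) := by rw [hI, lintegral_indicator_one hm]
  calc ∫⁻ x, ENNReal.ofReal |g (x - y) - g x|
      ≤ ∫⁻ x, (I (x - y) + I x) * (L * ENNReal.ofReal ‖y‖) := by
        refine lintegral_mono fun x => ?_
        have h : ENNReal.ofReal |g (x - y) - g x| ≤ L * ENNReal.ofReal ‖y‖ := by
          have h := hg.dist_le_mul (x - y) x
          rw [Real.dist_eq, dist_eq_norm, sub_sub_cancel_left, norm_neg] at h
          rw [← ENNReal.ofReal_coe_nnreal (p := L), ← ENNReal.ofReal_mul L.coe_nonneg]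
          exact ENNReal.ofReal_le_ofReal h
        by_cases h1 : x ∈ tsupport g
        · refine h.trans (le_mul_of_one_le_left zero_le ?_)
          simp [hI, h1]
        by_cases h2 : x - y ∈ tsupport g
        · refine h.trans (le_mul_of_one_le_left zero_le ?_)
          simp [hI, h2]
        · simp [image_eq_zero_of_notMem_tsupport h1, image_eq_zero_of_notMem_tsupport h2]
    _ = _ := by
        rw [lintegral_mul_const' _ _ (by finiteness), lintegral_add_right _ hIm,
          lintegral_sub_right_eq_self I, hIi, two_mul]

/-- Since S(t)g need not have compact support, a uniform bound alone does not control the modular;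
this L¹ bound of order √t supplies the missing decay. -/
theorem lintegral_abs_heat_sub_le (hg : LipschitzWith L g) (hgc : HasCompactSupport g)
    (ht : 0 < t) :
    ∫⁻ x, ENNReal.ofReal |heat n t g x - g x| ≤
      2 * volume (tsupport g) * L * ENNReal.ofReal (2 * √t * 2 ^ ((n : ℝ) / 2)) := by
  have hv : volume (tsupport g) ≠ ∞ := hgc.isCompact.measure_lt_top.ne
  have hc : Continuous fun p : EuclideanSpace ℝ (Fin n) × EuclideanSpace ℝ (Fin n) =>
      |g (p.1 - p.2) - g p.1| :=
    ((hg.continuous.comp (continuous_fst.sub continuous_snd)).sub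
      (hg.continuous.comp continuous_fst)).abs
  calc ∫⁻ x, ENNReal.ofReal |heat n t g x - g x|
      ≤ ∫⁻ x, ∫⁻ y, ENNReal.ofReal (heatKernel n y t) * ENNReal.ofReal |g (x - y) - g x| :=
        lintegral_mono fun x => ofReal_abs_heat_sub_le hg.continuous hgc ht x
    _ = ∫⁻ y, ∫⁻ x, ENNReal.ofReal (heatKernel n y t) * ENNReal.ofReal |g (x - y) - g x| := by
        refine lintegral_lintegral_swap (Measurable.aemeasurable ?_)
        exact (continuous_heatKernel.comp continuous_snd).measurable.ennreal_ofReal.mul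
          hc.measurable.ennreal_ofReal
    _ ≤ ∫⁻ y, 2 * volume (tsupport g) * L * ENNReal.ofReal (‖y‖ * heatKernel n y t) := by
        refine lintegral_mono fun y => ?_
        simp only
        rw [lintegral_const_mul' _ _ ENNReal.ofReal_ne_top]
        refine (mul_le_mul_right (lintegral_abs_translate_sub_le hg hgc y) _).trans_eq ?_
        rw [ENNReal.ofReal_mul (norm_nonneg _)]
        ring
    _ ≤ _ := by
        rw [lintegral_const_mul' _ _ (by finiteness)]
        exact mul_le_mul_right (lintegral_norm_mul_heatKernel_le ht) _

end testFunctions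

namespace Orlicz

variable {n : ℕ} {Φ : YoungFunction}

/-- Once |S(t)g - g| ≤ (ε/2)r, the chord of Φ on [0, r] bounds the modular at scale ε/2 by a
constant times the L¹ norm, which is O(√t). -/
theorem tendsto_heatSemigroup_of_lipschitz {u : Orlicz n Φ} {g : EuclideanSpace ℝ (Fin n) → ℝ}
    {L : ℝ≥0} (hg : LipschitzWith L g) (hgc : HasCompactSupport g) (hu : u =ᵐ[volume] g) :
    Tendsto (fun t => ‖heatSemigroup n Φ t u - u‖) (𝓝[>] 0) (𝓝 0) := by
  obtain ⟨r, hr, hΦ⟩ := Φ.exists_finite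
  have hv : volume (tsupport g) ≠ ∞ := hgc.isCompact.measure_lt_top.ne
  rw [Metric.tendsto_nhds]
  intro ε hε
  set m : ℝ≥0 → ℝ := fun t => 2 * √(t : ℝ) * 2 ^ ((n : ℝ) / 2) with hm
  have hmt : Tendsto m (𝓝[>] 0) (𝓝 0) := by
    have : Continuous m := by fun_prop
    have h := this.tendsto 0
    simp only [hm, NNReal.coe_zero, Real.sqrt_zero, mul_zero, zero_mul] at h
    exact h.mono_left nhdsWithin_le_nhds
  set A : ℝ≥0∞ := ENNReal.ofReal (ε / 2)⁻¹ * Φ (ENNReal.ofReal r) *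
    (2 * volume (tsupport g) * L) with hA
  have hAt : A ≠ ∞ := by have := hΦ.ne; finiteness
  have h1 : ∀ᶠ t in 𝓝[>] (0 : ℝ≥0), L * m t < ε / 2 * r := by
    have := hmt.const_mul (L : ℝ)
    rw [mul_zero] at this
    exact this.eventually_lt_const (by positivity)
  have h2 : ∀ᶠ t in 𝓝[>] (0 : ℝ≥0), A * ENNReal.ofReal (m t) < ENNReal.ofReal r := by
    have := ENNReal.Tendsto.const_mul (a := A) (ENNReal.tendsto_ofReal hmt) (Or.inr hAt)
    rw [ENNReal.ofReal_zero, mul_zero] at this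
    exact this.eventually_lt_const (ENNReal.ofReal_pos.2 hr)
  filter_upwards [h1, h2, self_mem_nhdsWithin] with t h1 h2 ht
  have ht' : (0 : ℝ) < t := by exact_mod_cast ht
  rw [dist_zero_right, norm_norm]
  have hae : (heatSemigroup n Φ t u - u : Orlicz n Φ) =ᵐ[volume] (heat n t g - g) := by
    refine (coeFn_sub _ _).trans (EventuallyEq.sub ?_ hu)
    rw [← heat_congr ht' hu]
    exact coeFn_heatSemigroup t u
  refine (norm_le_of_modular_ae hae (half_pos hε) ?_).trans_lt (half_lt_self hε)
  have hr0 : ENNReal.ofReal r ≠ 0 := (ENNReal.ofReal_pos.2 hr).ne'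
  have h := modular_mul_le (f := heat n t g - g) Φ (r := r) (half_pos hε) hΦ
    fun x => (abs_heat_sub_le hg hgc ht' x).trans h1.le
  refine (ENNReal.mul_le_mul_iff_left hr0 ENNReal.ofReal_ne_top).1
    (h.trans ((mul_le_mul_right (lintegral_abs_heat_sub_le hg hgc ht') _).trans ?_))
  rw [one_mul, ← mul_assoc]
  exact h2.le

/-- The approximation principle is applied to the compact set {u}; the Lipschitz constant 3 is the
operator bound 2 plus 1 for the identity. -/
theorem tendsto_heatSemigroup {u : Orlicz n Φ} (hu : u ∈ orliczZero n Φ) :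
    Tendsto (fun t => ‖heatSemigroup n Φ t u - u‖) (𝓝[>] 0) (𝓝 0) := by
  refine (tendstoUniformlyOn_zero_of_subset_closure (C := 3) (by norm_num)
    (isCompact_singleton (x := u)) (singleton_subset_iff.2 hu)
    (F := fun t v => ‖heatSemigroup n Φ t v - v‖)
    (Eventually.of_forall fun _ _ => norm_nonneg _) (Eventually.of_forall fun t v w => ?_)
    ?_).tendsto_at (mem_singleton u)
  · have h : heatSemigroup n Φ t v - v =
        (heatSemigroup n Φ t w - w) + (heatSemigroup n Φ t (v - w) - (v - w)) := by
      rw [map_sub]; abel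
    rw [h]
    linarith [norm_add_le (heatSemigroup n Φ t w - w)
      (heatSemigroup n Φ t (v - w) - (v - w)), norm_sub_le (heatSemigroup n Φ t (v - w)) (v - w),
      norm_heatSemigroup_le t (v - w)]
  · rintro v ⟨g, hg, hgc, hv⟩
    obtain ⟨L, hL⟩ := hg.lipschitzWith_of_hasCompactSupport hgc (by simp)
    exact tendsto_heatSemigroup_of_lipschitz hL hgc hv

end Orlicz

theorem YoungFunction.tendsto_apply_zero (Φ : YoungFunction) {ι : Type*} {l : Filter ι} {a : ι → ℝ}
    (ha : Tendsto a l (𝓝 0)) : Tendsto (fun i => Φ (ENNReal.ofReal (a i))) l (𝓝 0) := by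
  rw [ENNReal.tendsto_nhds_zero]
  intro ε hε
  obtain ⟨x, hx, hΦ⟩ := Φ.exists_pos_apply_le hε
  have hx' : (0 : ℝ) < x := by exact_mod_cast hx
  filter_upwards [ha.eventually_lt_const hx'] with i hi
  refine (Φ.mono ?_ ENNReal.coe_lt_top).trans hΦ
  rw [← ENNReal.ofReal_coe_nnreal]
  exact ENNReal.ofReal_le_ofReal hi.le

theorem YoungFunction.IsFinite.lt_top {Φ : YoungFunction} (h : Φ.IsFinite) (r : ℝ) :
    Φ (ENNReal.ofReal r) < ∞ := h.2.2.1 _ ENNReal.ofReal_lt_top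

/-! ### Density of test functions in the Morse–Transue space. -/

section density

variable {n : ℕ} {Φ : YoungFunction} {f : EuclideanSpace ℝ (Fin n) → ℝ}

/-- Mollification: bounded functions with bounded support are approximated by test functions. -/
theorem exists_contDiff_modular_sub_le (hΦ : Φ.IsFinite) (hf : Measurable f) {M R : ℝ}
    (hM : ∀ x, |f x| ≤ M) (hR : ∀ x ∉ Metric.closedBall 0 R, f x = 0) {k : ℝ} (hk : 0 < k) :
    ∃ g : EuclideanSpace ℝ (Fin n) → ℝ, ContDiff ℝ (⊤ : ℕ∞) g ∧ HasCompactSupport g ∧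
      modular Φ (f - g) k ≤ 1 := by
  have hfc : HasCompactSupport f := HasCompactSupport.intro (isCompact_closedBall 0 R) hR
  have hfi : Integrable f := by
    refine (integrableOn_iff_integrable_of_support_subset (s := Metric.closedBall 0 R) ?_).1 ?_
    · intro x hx
      by_contra h
      exact hx (hR x h)
    · exact Measure.integrableOn_of_bounded (M := M) measure_closedBall_lt_top.ne
        hf.aestronglyMeasurable (Eventually.of_forall hM)
  -- The fixed ratio of outer to inner radius is what the a.e. convergence of the mollifications
  -- requires.
  let ρ : ℕ → ContDiffBump (0 : EuclideanSpace ℝ (Fin n)) := fun i =>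
    { rIn := 1 / (i + 1 : ℝ) / 2
      rOut := 1 / (i + 1 : ℝ)
      rIn_pos := by positivity
      rIn_lt_rOut := half_lt_self (by positivity) }
  let g : ℕ → EuclideanSpace ℝ (Fin n) → ℝ := fun i =>
    convolution ((ρ i).normed volume) f (ContinuousLinearMap.lsmul ℝ ℝ) volume
  have hg : ∀ i, ContDiff ℝ (⊤ : ℕ∞) (g i) := fun i =>
    (ρ i).hasCompactSupport_normed.contDiff_convolution_left _ (ρ i).contDiff_normed
      hfi.locallyIntegrable
  have hgc : ∀ i, HasCompactSupport (g i) := fun i =>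
    HasCompactSupport.convolution _ (ρ i).hasCompactSupport_normed hfc
  have hgR : ∀ i, ∀ x ∉ Metric.closedBall 0 (R + 1), g i x = 0 := by
    intro i x hx
    by_contra h
    obtain ⟨y, hy, z, hz, rfl⟩ := support_convolution_subset _ h
    rw [(ρ i).support_normed_eq, Metric.mem_ball, dist_zero_right] at hy
    have hz' : ‖z‖ ≤ R := by
      by_contra hz'
      exact hz (hR z (by simpa using hz'))
    refine hx ?_
    rw [mem_closedBall_zero_iff]
    have : (ρ i).rOut ≤ 1 := by
      change 1 / (i + 1 : ℝ) ≤ 1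
      exact div_le_one_of_le₀ (by linarith [(i.cast_nonneg : (0 : ℝ) ≤ i)]) (by positivity)
    exact (norm_add_le y z).trans (by linarith)
  have hgM : ∀ i x, |g i x| ≤ M := by
    intro i x
    calc |g i x| = ‖∫ y, ContinuousLinearMap.lsmul ℝ ℝ ((ρ i).normed volume y) (f (x - y))‖ := rfl
      _ ≤ ∫ y, (ρ i).normed volume y * M := by
          refine norm_integral_le_of_norm_le (((ρ i).integrable_normed (μ := volume)).mul_const M)
            (Eventually.of_forall fun y => ?_)
          rw [ContinuousLinearMap.lsmul_apply, norm_smul,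
            Real.norm_of_nonneg ((ρ i).nonneg_normed y)]
          exact mul_le_mul_of_nonneg_left (hM _) ((ρ i).nonneg_normed y)
      _ = M := by rw [integral_mul_const, (ρ i).integral_normed, one_mul]
  have hlim : ∀ᵐ x, Tendsto (fun i => g i x) atTop (𝓝 (f x)) :=
    ContDiffBump.ae_convolution_tendsto_right_of_locallyIntegrable (φ := ρ) (K := 2)
      tendsto_one_div_add_atTop_nhds_zero_nat
      (Eventually.of_forall fun i => (mul_div_cancel₀ (1 / (i + 1 : ℝ)) two_ne_zero).ge)
      hfi.locallyIntegrable
  -- Dominated by the constant Φ(2M/k) on the ball of radius R + 1; that constant is finite because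
  -- Φ is of type (I).
  have hconv : Tendsto (fun i => modular Φ (f - g i) k) atTop
      (𝓝 (∫⁻ _ : EuclideanSpace ℝ (Fin n), 0)) := by
    refine tendsto_lintegral_of_dominated_convergence
      ((Metric.closedBall 0 (R + 1)).indicator fun _ => Φ (ENNReal.ofReal ((M + M) / k)))
      (fun i => measurable_apply_abs_div Φ (hf.sub (hg i).continuous.measurable) k)
      (fun i => Eventually.of_forall fun x => ?_) ?_ ?_
    · by_cases hx : x ∈ Metric.closedBall 0 (R + 1)
      · rw [indicator_of_mem hx]
        refine Φ.mono_real ?_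
        gcongr
        exact (abs_sub _ _).trans (add_le_add (hM x) (hgM i x))
      · have hx' : x ∉ Metric.closedBall 0 R := fun h =>
          hx (Metric.closedBall_subset_closedBall (by linarith) h)
        simp [hR x hx', hgR i x hx, Φ.zero']
    · rw [lintegral_indicator Metric.isClosed_closedBall.measurableSet, setLIntegral_const]
      exact (ENNReal.mul_lt_top (hΦ.lt_top _) measure_closedBall_lt_top).ne
    · filter_upwards [hlim] with x hx
      refine Φ.tendsto_apply_zero ?_
      have := ((tendsto_const_nhds (x := f x)).sub hx).abs.div_const k
      simpa using this
  rw [lintegral_zero] at hconv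
  obtain ⟨i, hi⟩ := (hconv.eventually_le_const one_pos).exists
  exact ⟨g i, hg i, hgc i, hi⟩

/-- Truncation in space and in height. -/
theorem exists_truncation_modular_sub_le (hf : Measurable f) {k : ℝ} (h : modular Φ f k < ∞) :
    ∃ m : ℕ, modular Φ (f - {x | ‖x‖ ≤ m ∧ |f x| ≤ m}.indicator f) k ≤ 1 := by
  have hs : ∀ m : ℕ, MeasurableSet {x | ‖x‖ ≤ m ∧ |f x| ≤ m} := fun m =>
    (measurableSet_le measurable_norm measurable_const).inter
      (measurableSet_le (continuous_abs.measurable.comp hf) measurable_const)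
  have hconv : Tendsto (fun m : ℕ => modular Φ (f - {x | ‖x‖ ≤ m ∧ |f x| ≤ m}.indicator f) k)
      atTop (𝓝 (∫⁻ _ : EuclideanSpace ℝ (Fin n), 0)) := by
    refine tendsto_lintegral_of_dominated_convergence
      (fun x => Φ (ENNReal.ofReal (|f x| / k)))
      (fun m => measurable_apply_abs_div Φ (hf.sub (hf.indicator (hs m))) k)
      (fun m => Eventually.of_forall fun x => ?_) h.ne (Eventually.of_forall fun x => ?_)
    · by_cases hx : x ∈ {x | ‖x‖ ≤ m ∧ |f x| ≤ m}
      · simp [indicator_of_mem hx, Φ.zero']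
      · simp [indicator_of_notMem hx]
    · obtain ⟨N, hN⟩ := exists_nat_ge (max ‖x‖ |f x|)
      refine tendsto_const_nhds.congr' ?_
      filter_upwards [eventually_ge_atTop N] with m hm
      have hm' : (N : ℝ) ≤ m := by exact_mod_cast hm
      have hx : x ∈ {x | ‖x‖ ≤ m ∧ |f x| ≤ m} :=
        ⟨(le_max_left _ _).trans (hN.trans hm'), (le_max_right _ _).trans (hN.trans hm')⟩
      simp [indicator_of_mem hx, Φ.zero']
  rw [lintegral_zero] at hconv
  exact (hconv.eventually_le_const one_pos).exists

/-- For a finite Young's function, test functions are dense in the Morse–Transue space. -/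
theorem morseTransue_subset_orliczZero (hΦ : Φ.IsFinite) :
    (morseTransue n Φ : Set (Orlicz n Φ)) ⊆ orliczZero n Φ := by
  intro u hu
  refine Metric.mem_closure_iff.2 fun ε hε => ?_
  -- Truncation and mollification errors each have modular at most 1 at scale ε/4, so by convexity
  -- their sum has norm at most ε/2 < ε.
  have hε' : 0 < ε / 4 := by positivity
  obtain ⟨m, hm⟩ := exists_truncation_modular_sub_le u.measurable (hu (ε / 4) hε')
  have hs : MeasurableSet {x | ‖x‖ ≤ m ∧ |u x| ≤ m} :=
    (measurableSet_le measurable_norm measurable_const).inter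
      (measurableSet_le (continuous_abs.measurable.comp u.measurable) measurable_const)
  set v := {x | ‖x‖ ≤ m ∧ |u x| ≤ m}.indicator u with hv
  have hvm : Measurable v := u.measurable.indicator hs
  obtain ⟨g, hg, hgc, hgv⟩ := exists_contDiff_modular_sub_le hΦ hvm (M := m) (R := m)
    (fun x => by
      by_cases hx : x ∈ {x | ‖x‖ ≤ m ∧ |u x| ≤ m}
      · rw [hv, indicator_of_mem hx]; exact hx.2
      · rw [hv, indicator_of_notMem hx, abs_zero]; exact m.cast_nonneg)
    (fun x hx => indicator_of_notMem (fun h => hx (mem_closedBall_zero_iff.2 h.1)) _) hε'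
  refine ⟨Orlicz.ofFun g hg.continuous.aestronglyMeasurable
    (exists_modular_lt_top Φ hg.continuous hgc), ⟨g, hg, hgc, Orlicz.coeFn_ofFun _ _⟩, ?_⟩
  rw [dist_eq_norm]
  have hae : (u - Orlicz.ofFun g hg.continuous.aestronglyMeasurable
      (exists_modular_lt_top Φ hg.continuous hgc) : Orlicz n Φ) =ᵐ[volume]
        ((u - v) + (v - g)) := by
    refine (Orlicz.coeFn_sub _ _).trans ?_
    rw [sub_add_sub_cancel]
    exact EventuallyEq.rfl.sub (Orlicz.coeFn_ofFun _ _)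
  refine (Orlicz.norm_le_of_modular_ae hae (k := ε / 4 + ε / 4) (by positivity) ?_).trans_lt
    (by linarith)
  refine (modular_add Φ (u.measurable.sub hvm).aemeasurable hε' hε').trans
    ((add_le_add (mul_le_mul_right hm _) (mul_le_mul_right hgv _)).trans ?_)
  rw [mul_one, ← ENNReal.ofReal_add (by positivity) (by positivity), ← add_div,
    div_self (by positivity), ENNReal.ofReal_one]

end density

/-! ### The semigroup on the Morse–Transue space. -/

namespace Orlicz

variable {n : ℕ} {Φ : YoungFunction}

theorem heatSemigroup_mem_morseTransue (t : ℝ≥0) {u : Orlicz n Φ} (hu : u ∈ morseTransue n Φ) :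
    heatSemigroup n Φ t u ∈ morseTransue n Φ := by
  intro k hk
  rw [modular_congr Φ (coeFn_heatSemigroup t u)]
  rcases t.coe_nonneg.eq_or_lt with ht | ht
  · rw [← ht, heat_zero]
    exact hu k hk
  · have h := modular_heat_le Φ u.measurable ht (half_pos hk)
    rw [mul_div_cancel₀ k two_ne_zero] at h
    exact h.trans_lt (hu _ (half_pos hk))

/-- The heat semigroup on the Morse–Transue space. -/
noncomputable def heatSemigroupMorseTransue (n : ℕ) (Φ : YoungFunction) (t : ℝ≥0) :
    morseTransue n Φ →L[ℝ] morseTransue n Φ :=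
  ((heatSemigroup n Φ t).comp (morseTransue n Φ).subtypeL).codRestrict (morseTransue n Φ)
    fun u => heatSemigroup_mem_morseTransue t u.2

theorem isC0Semigroup_heatSemigroupMorseTransue (hΦ : Φ.IsFinite) :
    IsC0Semigroup (heatSemigroupMorseTransue n Φ) where
  map_zero := by
    ext1 u
    exact Subtype.ext (heatSemigroup_zero_apply u.1)
  map_add s t := by
    ext1 u
    exact Subtype.ext (congrArg (fun T => T u.1) (isOperatorSemigroup_heatSemigroup.map_add s t))
  tendsto_zero u := tendsto_iff_norm_sub_tendsto_zero.2
    (tendsto_heatSemigroup (morseTransue_subset_orliczZero hΦ u.2))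

end Orlicz

/-! ### Smoothing from L^Φ to L^Ψ. -/

namespace YoungFunction

theorem toReal_inv_pos (Φ : YoungFunction) {s : ℝ} (hs : 0 < s) :
    0 < (Φ.inv (ENNReal.ofReal s)).toReal :=
  ENNReal.toReal_pos (Φ.inv_pos (ENNReal.ofReal_pos.2 hs)).ne'
    (Φ.inv_lt_top ENNReal.ofReal_lt_top).ne

theorem ofReal_toReal_inv (Φ : YoungFunction) (s : ℝ) :
    ENNReal.ofReal (Φ.inv (ENNReal.ofReal s)).toReal = Φ.inv (ENNReal.ofReal s) :=
  ENNReal.ofReal_toReal (Φ.inv_lt_top ENNReal.ofReal_lt_top).ne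

end YoungFunction

section smoothing

variable {n : ℕ} {Φ Ψ Θ : YoungFunction} {β : ℝ≥0}

/-- The smoothing estimate for modulars. -/
theorem modular_heat_le_one_of_compatible (hβ : 0 < β)
    (h : ∀ x : ℝ≥0, β * x * Ψ.inv x ≤ Φ.inv x * Θ.inv x ∧ Φ.inv x * Θ.inv x ≤ x * Ψ.inv x)
    {t : ℝ} (ht : 0 < t) {φ : EuclideanSpace ℝ (Fin n) → ℝ} (hφ : Measurable φ) {k : ℝ}
    (hk : 0 < k) (hφk : modular Φ φ k ≤ 1) :
    modular Ψ (heat n t φ) (4 / β * ((Φ.inv (ENNReal.ofReal (t ^ (-(n : ℝ) / 2)))).toReal /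
      (Ψ.inv (ENNReal.ofReal (t ^ (-(n : ℝ) / 2)))).toReal) * k) ≤ 1 := by
  have hs : 0 < t ^ (-(n : ℝ) / 2) := by positivity
  -- The comparison is made with v = |S(t)φ|/(2k), whose Φ-modular is already bounded. In 4/β one
  -- factor 2 comes from Jensen, the other from the strict inequality in the comparison, and 1/β
  -- from the almost monotone ratio.
  refine le_trans (lintegral_mono fun x => ?_) ((modular_heat_le Φ hφ ht hk).trans hφk)
  refine YoungFunction.apply_le_apply_of_compatible h (s := (t ^ (-(n : ℝ) / 2)).toNNReal)
    (Real.toNNReal_pos.2 hs) ENNReal.ofReal_lt_top ?_ ?_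
  -- The L¹–L^∞ bound for the kernel, applied to Φ(|φ|/k), gives Φ(v) ≤ t^(-n/2).
  · refine (apply_heat_le Φ hφ ht hk x).trans
      ((lintegral_heatKernel_mul_le_modular Φ ht k x).trans ?_)
    exact mul_le_of_le_one_right zero_le hφk
  · change 2 * _ * Φ.inv (ENNReal.ofReal _) ≤ β * _ * Ψ.inv (ENNReal.ofReal _)
    have ha' := (Φ.ofReal_toReal_inv (t ^ (-(n : ℝ) / 2))).symm
    have hb' := (Ψ.ofReal_toReal_inv (t ^ (-(n : ℝ) / 2))).symm
    have ha := Φ.toReal_inv_pos hs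
    have hb := Ψ.toReal_inv_pos hs
    set a := (Φ.inv (ENNReal.ofReal (t ^ (-(n : ℝ) / 2)))).toReal
    set b := (Ψ.inv (ENNReal.ofReal (t ^ (-(n : ℝ) / 2)))).toReal
    have hβ' : (0 : ℝ) < β := by exact_mod_cast hβ
    rw [ha', hb', ← ENNReal.ofReal_coe_nnreal (p := β), ← ENNReal.ofReal_ofNat 2,
      ← ENNReal.ofReal_mul (by positivity), ← ENNReal.ofReal_mul (by positivity),
      ← ENNReal.ofReal_mul (by positivity), ← ENNReal.ofReal_mul (by positivity)]
    refine ENNReal.ofReal_le_ofReal (le_of_eq ?_)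
    field_simp
    ring

/-- The smoothing operators `L^Φ → L^Ψ`, set to zero for nonpositive times. -/
noncomputable def heatSmoothing (n : ℕ) (hβ : 0 < β)
    (h : ∀ x : ℝ≥0, β * x * Ψ.inv x ≤ Φ.inv x * Θ.inv x ∧ Φ.inv x * Θ.inv x ≤ x * Ψ.inv x)
    (t : ℝ) : Orlicz n Φ →L[ℝ] Orlicz n Ψ :=
  if ht : 0 < t then
    Orlicz.heatCLM Φ Ψ t ht.le _
      (have hs : 0 < t ^ (-(n : ℝ) / 2) := by positivity
        mul_pos (div_pos four_pos (NNReal.coe_pos.2 hβ))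
          (div_pos (Φ.toReal_inv_pos hs) (Ψ.toReal_inv_pos hs)))
      fun _ hφ _ hk hφk => modular_heat_le_one_of_compatible hβ h ht hφ hk hφk
  else 0

variable (hβ : 0 < β)
  (h : ∀ x : ℝ≥0, β * x * Ψ.inv x ≤ Φ.inv x * Θ.inv x ∧ Φ.inv x * Θ.inv x ≤ x * Ψ.inv x)

theorem coeFn_heatSmoothing {t : ℝ} (ht : 0 < t) (u : Orlicz n Φ) :
    heatSmoothing n hβ h t u =ᵐ[volume] heat n t u := by
  rw [heatSmoothing, dif_pos ht]
  exact Orlicz.coeFn_heatCLM u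

theorem norm_heatSmoothing_le {t : ℝ} (ht : 0 < t) (u : Orlicz n Φ) :
    ‖heatSmoothing n hβ h t u‖ ≤
      4 / β * ((Φ.inv (ENNReal.ofReal (t ^ (-(n : ℝ) / 2)))).toReal /
        (Ψ.inv (ENNReal.ofReal (t ^ (-(n : ℝ) / 2)))).toReal) * ‖u‖ := by
  rw [heatSmoothing, dif_pos ht]
  exact Orlicz.norm_heatCLM_le u

theorem tendsto_toReal_inv_div (hn : 1 ≤ n)
    (hlim : Tendsto (fun s : ℝ≥0 => Ψ.inv s / Φ.inv s) atTop (𝓝 0)) :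
    Tendsto (fun t : ℝ => (Ψ.inv (ENNReal.ofReal (t ^ (-(n : ℝ) / 2)))).toReal /
      (Φ.inv (ENNReal.ofReal (t ^ (-(n : ℝ) / 2)))).toReal) (𝓝[>] 0) (𝓝 0) := by
  -- Positive dimension is what sends t^(-n/2) to infinity as t → 0.
  have hn' : -(n : ℝ) / 2 < 0 := by
    have : (1 : ℝ) ≤ n := by exact_mod_cast hn
    linarith
  have h1 := hlim.comp (tendsto_real_toNNReal_atTop.comp (tendsto_rpow_neg_nhdsGT_zero hn'))
  have h2 := (ENNReal.tendsto_toReal ENNReal.zero_ne_top).comp h1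
  refine h2.congr fun t => ?_
  simp only [Function.comp_apply, ENNReal.toReal_div]
  rfl

/-- The weight cancels the ratio in the smoothing estimate, so the functionals are Lipschitz with
constant 4/β for every t > 0. On a test function, which lies in L^Ψ as well, ‖S(t)g‖_Ψ ≤ 2‖g‖_Ψ and
the weight alone forces the limit. -/
theorem tendstoUniformlyOn_heatSmoothing (hn : 1 ≤ n)
    (hlim : Tendsto (fun s : ℝ≥0 => Ψ.inv s / Φ.inv s) atTop (𝓝 0))
    {K : Set (Orlicz n Φ)} (hK : K ⊆ orliczZero n Φ) (hKc : IsCompact K) :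
    TendstoUniformlyOn
      (fun (t : ℝ) φ => (Ψ.inv (ENNReal.ofReal (t ^ (-(n : ℝ) / 2)))).toReal /
        (Φ.inv (ENNReal.ofReal (t ^ (-(n : ℝ) / 2)))).toReal * ‖heatSmoothing n hβ h t φ‖)
      (fun _ => 0) (𝓝[>] 0) K := by
  have hβ' : (0 : ℝ) < β := by exact_mod_cast hβ
  refine tendstoUniformlyOn_zero_of_subset_closure (C := 4 / β) (by positivity) hKc hK
    (Eventually.of_forall fun _ _ => by positivity) ?_ ?_
  · filter_upwards [self_mem_nhdsWithin] with t ht u v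
    have hs : 0 < t ^ (-(n : ℝ) / 2) := Real.rpow_pos_of_pos ht _
    have ha := Φ.toReal_inv_pos hs
    have hb := Ψ.toReal_inv_pos hs
    have huv := norm_heatSmoothing_le hβ h ht (u - v)
    set a := (Φ.inv (ENNReal.ofReal (t ^ (-(n : ℝ) / 2)))).toReal
    set b := (Ψ.inv (ENNReal.ofReal (t ^ (-(n : ℝ) / 2)))).toReal
    have hle : ‖heatSmoothing n hβ h t u‖ ≤
        ‖heatSmoothing n hβ h t v‖ + ‖heatSmoothing n hβ h t (u - v)‖ := by
      rw [map_sub]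
      simpa using norm_add_le (heatSmoothing n hβ h t v)
        (heatSmoothing n hβ h t u - heatSmoothing n hβ h t v)
    calc b / a * ‖heatSmoothing n hβ h t u‖
        ≤ b / a * (‖heatSmoothing n hβ h t v‖ + 4 / β * (a / b) * ‖u - v‖) := by
          gcongr; exact hle.trans (by gcongr)
      _ = _ := by field_simp
  · rintro u ⟨g, hg, hgc, hu⟩
    have hgm := exists_modular_lt_top Ψ hg.continuous hgc
    set w : Orlicz n Ψ := Orlicz.ofFun g hg.continuous.aestronglyMeasurable hgm
    have hwg : w =ᵐ[volume] g := Orlicz.coeFn_ofFun _ _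
    have hlim' := (tendsto_toReal_inv_div hn hlim).mul_const (2 * ‖w‖)
    rw [zero_mul] at hlim'
    refine squeeze_zero' (Eventually.of_forall fun _ => by positivity) ?_ hlim'
    filter_upwards [self_mem_nhdsWithin] with t ht
    have ht' : 0 < t := ht
    -- The class u in L^Φ and the class w in L^Ψ both represent g, so both operators produce the
    -- same function.
    have heq : ‖heatSmoothing n hβ h t u‖ = ‖Orlicz.heatSemigroup n Ψ ⟨t, ht'.le⟩ w‖ := by
      rw [Orlicz.norm_congr (coeFn_heatSmoothing hβ h ht' u),
        Orlicz.norm_congr (Orlicz.coeFn_heatSemigroup ⟨t, ht'.le⟩ w)]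
      change luxemburg Ψ (heat n t u) = luxemburg Ψ (heat n t w)
      rw [heat_congr ht' hu, heat_congr ht' hwg]
    rw [heq]
    gcongr
    exact Orlicz.norm_heatSemigroup_le _ w

end smoothing

theorem theoremA (n : ℕ) (hn : 1 ≤ n) (Φ : YoungFunction) :
    -- the integral defining `S(t)φ` converges absolutely at every point
    (∀ (φ : Orlicz n Φ) (t : ℝ), 0 < t → ∀ x,
      Integrable (fun y => heatKernel n (x - y) t * φ y)) ∧
    -- (a) semigroups
    (∃ S : ℝ≥0 → Orlicz n Φ →L[ℝ] Orlicz n Φ,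
      (∀ t φ, S t φ =ᵐ[volume] heat n t φ) ∧
      -- (i)
      IsOperatorSemigroup S ∧
      (∀ t φ, ‖S t φ‖ ≤ 2 * ‖φ‖) ∧
      -- (ii)
      (∀ φ ∈ orliczZero n Φ, Tendsto (fun t => ‖S t φ - φ‖) (𝓝[>] 0) (𝓝 0)) ∧
      -- (iii)
      (Φ.IsNFunction →
        ∃ T : ℝ≥0 → morseTransue n Φ →L[ℝ] morseTransue n Φ,
          (∀ t φ, (T t φ : Orlicz n Φ) = S t φ) ∧
          IsC0Semigroup T ∧
          (∀ t φ, ‖T t φ‖ ≤ 2 * ‖φ‖))) ∧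
    -- (b) smoothing
    (∀ Ψ : YoungFunction, Φ.Compatible Ψ →
      ∃ S : ℝ → Orlicz n Φ →L[ℝ] Orlicz n Ψ,
        (∀ t, 0 < t → ∀ φ, S t φ =ᵐ[volume] heat n t φ) ∧
        -- (i)
        (∃ C : ℝ, 0 < C ∧ ∀ φ t, 0 < t →
          ‖S t φ‖ ≤ C * ((Φ.inv (ENNReal.ofReal (t ^ (-(n : ℝ) / 2)))).toReal /
            (Ψ.inv (ENNReal.ofReal (t ^ (-(n : ℝ) / 2)))).toReal) * ‖φ‖) ∧
        -- (ii)
        (Tendsto (fun s : ℝ≥0 => Ψ.inv s / Φ.inv s) atTop (𝓝 0) →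
          ∀ K ⊆ orliczZero n Φ, IsCompact K →
            TendstoUniformlyOn
              (fun (t : ℝ) φ => (Ψ.inv (ENNReal.ofReal (t ^ (-(n : ℝ) / 2)))).toReal /
                (Φ.inv (ENNReal.ofReal (t ^ (-(n : ℝ) / 2)))).toReal * ‖S t φ‖)
              (fun _ => 0) (𝓝[>] 0) K)) := by
  refine ⟨fun φ t ht x => ?_, ⟨Orlicz.heatSemigroup n Φ, Orlicz.coeFn_heatSemigroup,
    Orlicz.isOperatorSemigroup_heatSemigroup, Orlicz.norm_heatSemigroup_le,
    fun φ hφ => Orlicz.tendsto_heatSemigroup hφ, fun hΦ =>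
      ⟨Orlicz.heatSemigroupMorseTransue n Φ, fun _ _ => rfl,
        Orlicz.isC0Semigroup_heatSemigroupMorseTransue hΦ.1,
        fun t φ => Orlicz.norm_heatSemigroup_le t φ.1⟩⟩, ?_⟩
  · obtain ⟨k, hk, hφ⟩ := φ.2
    exact integrable_heatKernel_mul φ.measurable ht hk hφ x
  · rintro Ψ ⟨β, hβ, -, Θ, h⟩
    exact ⟨heatSmoothing n hβ h, fun t ht φ => coeFn_heatSmoothing hβ h ht φ,
      ⟨4 / β, div_pos four_pos (NNReal.coe_pos.2 hβ),
        fun φ t ht => norm_heatSmoothing_le hβ h ht φ⟩,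
      fun hlim K hK hKc => tendstoUniformlyOn_heatSmoothing hβ h hn hlim hK hKc⟩
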